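/- Let $K$ be an algebraically closed field of characteristic zero. All superalgebras are finite-dimensional, associative, not necessarily unital, and $\mathbb Z_2$-graded: $A=A_{\bar0}\oplus A_{\bar1}$ with $A_\alpha A_\beta\subseteq A_{\alpha+\beta}$; $|x|$ is the degree of a homogeneous element $x$. An even-symmetric associative superalgebra $(A,B)$ is such an $A$ with a bilinear form $B$ that is even ($B(A_{\bar0},A_{\bar1})=B(A_{\bar1},A_{\bar0})=0$), supersymmetric ($B(x,y)=(-1)^{|x||y|}B(y,x)$ for homogeneous $x,y$), associative ($B(xy,z)=B(x,yz)$) and non-degenerate. Isomorphisms of superalgebras preserve degrees. $M_{r,s}(K)$ ($r\ge1$, $s\ge0$) is the algebra of $(r+s)\times(r+s)$ matrices, whose even part is the set of block-diagonal matrices and whose odd part is the set of block-antidiagonal matrices. $Q_n(K)$ ($n\ge1$) is its sub-superalgebra $\left\{\begin{pmatrix}a&b\\ b&a\end{pmatrix}: a,b\in M_n(K)\right\}$ in the case $r=s=n$. Let $\mathcal O$ consist of $\{0\}$, the one-dimensional algebra with null product (concentrated in degree $\bar 0$), and the superalgebras $M_{r,s}(K)$, $r\ge1$, $s\ge0$ (up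 to isomorphism of superalgebras, and with any even-symmetric structure). Let $(W,\tilde B)$ be an even-symmetric associative superalgebra and $V$ an associative superalgebra. The dual $V^*$ is graded so that $(V^*)_\alpha$ consists of the linear forms vanishing on $V_{\alpha+\bar1}$. A context of generalized double extension of $W$ by $V$ consists of even linear, respectively bilinear, maps $\mu:V\to\mathrm{End}(W)$, $\lambda:V\times V\to W$, $\gamma:V\times V\to V^*$ such that, with $\mu':V\to \mathrm{End}(W)$ the linear map determined by $\tilde B(\mu(v)x,y)=(-1)^{|v|(|x|+|y|)}\tilde B(x,\mu'(v)y)$ for homogeneous $v,x,y$, one has for all $v,v',v''\in V$ and $x,y\in W$ $$\mu'(v)(xy)=x\,\mu'(v)(y),\qquad \mu'(v')\mu(v)=\mu(v)\mu'(v'),\qquad \mu'(vv')(x)=\mu'(v')\mu'(v)(x)-x\,\lambda(v,v'),$$ $$\mu'(v'')(\lambda(v,v'))=\mu(v)(\lambda(v',v''))+\lambda(v,v'v'')-\lambda(vv',v''),$$ and for all homogeneous $v,v',v'',v'''\in V$, with $\varepsilon=(-1)^{|v|(|v'|+|v''|+|v'''|)}$, $$\gamma(v,v')(v'')=(-1)^{|v|(|v'|+|v''|)}\gamma(v',v'')(v),$$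 $$-\tilde B(\lambda(v,v'),\lambda(v'',v'''))+\varepsilon\tilde B(\lambda(v',v''),\lambda(v''',v))=\gamma(vv',v'')(v''')+\gamma(v,v')(v''v''')-\gamma(v,v'v'')(v''')-\varepsilon\,\gamma(v',v'')(v'''v).$$ An even-symmetric associative superalgebra is a generalized double extension of $W$ by $V$ if, for some context, it is isomorphic, as a superalgebra with bilinear form, to $V\oplus W\oplus V^*$ with the following product and form, written for homogeneous elements $v+x+f$ and $w+y+g$ of degrees $|x|$ and $|y|$: $$(v+x+f)(w+y+g)=vw+\big(\lambda(v,w)+xy+\mu(v)(y)+\mu'(w)(x)\big)+h,$$ $$B(v+x+f,\,w+y+g)=\tilde B(x,y)+(-1)^{|x||y|}g(v)+f(w),$$ where $h\in V^*$ is given by $$h(t)=\gamma(v,w)(t)+\tilde B(x,\mu'(t)y)+(-1)^{|v|}\tilde B(y,\lambda(t,v))+\tilde B(x,\lambda(w,t))+(-1)^{|v|}g(tv)+f(wt)\qquad(t\in V).$$ If $V$ is the one-dimensional superalgebra with null product and even (respectively odd) generator, the extension is called an even (respectively odd) generalized double extension of $W$ by $V$. The orthogonal direct sum of $(A_1,B_1)$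 and $(A_2,B_2)$ is $A_1\oplus A_2$ with componentwise product and grading and the form $B_1\oplus B_2$. **Statement.** Let $(A,B)$ be an even-symmetric associative superalgebra. If $A\notin\mathcal O$, then $(A,B)$ is obtained from finitely many elements of $\mathcal O$ by a finite sequence of operations, each of which is one of the following: a generalized double extension by some $M_{r,s}(K)$ ($r\ge1$, $s\ge0$) or some $Q_n(K)$ ($n\ge1$); an even generalized double extension by the one-dimensional algebra with null product; an odd generalized double extension by the one-dimensional superalgebra with null product and null even part; an orthogonal direct sum. -/

import Mathlib

universe u v w

/-- A finite-dimensional associative superalgebra over `K`: a finite-dimensional associative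
`K`-algebra (not assumed unital) `A = A₀ ⊕ A₁` with `A_i A_j ⊆ A_{i+j}`, `i, j ∈ ℤ/2`. -/
structure AssocSuperalgebra (K : Type u) [Field K] where
  carrier : Type v
  [nonUnitalRing : NonUnitalRing carrier]
  [module : Module K carrier]
  [isScalarTower : IsScalarTower K carrier carrier]
  [smulCommClass : SMulCommClass K carrier carrier]
  [finiteDimensional : FiniteDimensional K carrier]
  grade : ZMod 2 → Submodule K carrier
  isCompl_grade : IsCompl (grade 0) (grade 1)
  mul_mem_grade : ∀ (i j : ZMod 2) (x y : carrier),
    x ∈ grade i → y ∈ grade j → x * y ∈ grade (i + j)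

namespace AssocSuperalgebra

attribute [instance] nonUnitalRing module isScalarTower smulCommClass finiteDimensional

instance {K : Type u} [Field K] : CoeSort (AssocSuperalgebra.{u, v} K) (Type v) :=
  ⟨carrier⟩

/-- The sign `(-1) ^ i` for `i ∈ ℤ/2`. -/
def sgn (K : Type u) [Field K] (i : ZMod 2) : K := (-1) ^ i.val

variable {K : Type u} [Field K]

/-- The grading of the dual space `V*`: `(V*)_i` consists of the linear forms that vanish on
`V_{i+1}`. -/
def dualGrade (V : AssocSuperalgebra.{u, v} K) (i : ZMod 2) :
    Submodule K (Module.Dual K V) :=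
  (V.grade (i + 1)).dualAnnihilator

/-- Isomorphism of superalgebras: a linear bijection that respects products and degrees. -/
def Isomorphic (A : AssocSuperalgebra.{u, v} K) (A' : AssocSuperalgebra.{u, w} K) : Prop :=
  ∃ e : A ≃ₗ[K] A', (∀ x y : A, e (x * y) = e x * e y) ∧
    ∀ (i : ZMod 2) (x : A), e x ∈ A'.grade i ↔ x ∈ A.grade i

/-- `V` is the one-dimensional superalgebra with null product concentrated in degree `i`. -/
def IsNullLine (i : ZMod 2) (V : AssocSuperalgebra.{u, v} K) : Prop :=
  Module.finrank K V = 1 ∧ V.grade i = ⊤ ∧ ∀ x y : V, x * y = 0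

/-- The block in which an index of a matrix of size `r + s` lies. -/
def blockParity (r s : ℕ) : Fin r ⊕ Fin s → ZMod 2 :=
  Sum.elim (fun _ => 0) (fun _ => 1)

/-- Degree `0`: block-diagonal matrices; degree `1`: block-antidiagonal matrices. -/
def matrixGrade (K : Type u) [Field K] (r s : ℕ) (i : ZMod 2) :
    Submodule K (Matrix (Fin r ⊕ Fin s) (Fin r ⊕ Fin s) K) where
  carrier := {M | ∀ a b, blockParity r s a + blockParity r s b ≠ i → M a b = 0}
  zero_mem' := fun _ _ _ => rfl
  add_mem' := by
    intro M N hM hN a b h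
    simp [hM a b h, hN a b h]
  smul_mem' := by
    intro c M hM a b h
    simp [hM a b h]

theorem matrixGrade_mul (K : Type u) [Field K] (r s : ℕ) (i j : ZMod 2)
    (M N : Matrix (Fin r ⊕ Fin s) (Fin r ⊕ Fin s) K)
    (hM : M ∈ matrixGrade K r s i) (hN : N ∈ matrixGrade K r s j) :
    M * N ∈ matrixGrade K r s (i + j) := by
  intro a b h
  rw [Matrix.mul_apply]
  refine Finset.sum_eq_zero fun c _ => ?_
  by_cases h1 : blockParity r s a + blockParity r s c = i
  · by_cases h2 : blockParity r s c + blockParity r s b = j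
    · refine absurd ?_ h
      rw [← h1, ← h2]
      generalize blockParity r s a = p
      generalize blockParity r s b = q
      generalize blockParity r s c = t
      revert p q t
      decide
    · rw [hN c b h2, mul_zero]
  · rw [hM a c h1, zero_mul]

theorem matrixGrade_disjoint (K : Type u) [Field K] (r s : ℕ)
    (M : Matrix (Fin r ⊕ Fin s) (Fin r ⊕ Fin s) K)
    (h0 : M ∈ matrixGrade K r s 0) (h1 : M ∈ matrixGrade K r s 1) : M = 0 := by
  ext a b
  by_cases h : blockParity r s a + blockParity r s b = 0
  · exact h1 a b (by rw [h]; decide)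
  · exact h0 a b h

/-- The superalgebra `M_{r,s}(K)`. -/
def matrixSuperalgebra (K : Type u) [Field K] (r s : ℕ) : AssocSuperalgebra.{u, u} K where
  carrier := Matrix (Fin r ⊕ Fin s) (Fin r ⊕ Fin s) K
  grade := matrixGrade K r s
  isCompl_grade := by
    constructor
    · rw [Submodule.disjoint_def]
      exact matrixGrade_disjoint K r s
    · rw [codisjoint_iff, eq_top_iff]
      intro M _
      rw [Submodule.mem_sup]
      refine ⟨Matrix.of fun a b => if blockParity r s a + blockParity r s b = 0 then M a b else 0,
        ?_, Matrix.of fun a b => if blockParity r s a + blockParity r s b = 0 then 0 else M a b,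
        ?_, ?_⟩
      · intro a b h
        simp [h]
      · intro a b h
        have key : ∀ t : ZMod 2, t ≠ 1 → t = 0 := by decide
        simp [key _ h]
      · ext a b
        by_cases h : blockParity r s a + blockParity r s b = 0 <;> simp [h]
  mul_mem_grade := matrixGrade_mul K r s

/-- The algebra of all matrices `(a, b; b, a)` with `a`, `b` square matrices of size `n`. -/
def queerSubalgebra (K : Type u) [Field K] (n : ℕ) :
    NonUnitalSubalgebra K (Matrix (Fin n ⊕ Fin n) (Fin n ⊕ Fin n) K) where
  carrier := {M | M.toBlocks₁₁ = M.toBlocks₂₂ ∧ M.toBlocks₁₂ = M.toBlocks₂₁}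
  zero_mem' := ⟨rfl, rfl⟩
  add_mem' := by
    rintro M N ⟨h1, h2⟩ ⟨h3, h4⟩
    constructor
    · change M.toBlocks₁₁ + N.toBlocks₁₁ = M.toBlocks₂₂ + N.toBlocks₂₂
      rw [h1, h3]
    · change M.toBlocks₁₂ + N.toBlocks₁₂ = M.toBlocks₂₁ + N.toBlocks₂₁
      rw [h2, h4]
  smul_mem' := by
    rintro c M ⟨h1, h2⟩
    constructor
    · change c • M.toBlocks₁₁ = c • M.toBlocks₂₂
      rw [h1]
    · change c • M.toBlocks₁₂ = c • M.toBlocks₂₁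
      rw [h2]
  mul_mem' := by
    rintro M N ⟨h1, h2⟩ ⟨h3, h4⟩
    have h := Matrix.fromBlocks_multiply M.toBlocks₁₁ M.toBlocks₁₂ M.toBlocks₂₁ M.toBlocks₂₂
      N.toBlocks₁₁ N.toBlocks₁₂ N.toBlocks₂₁ N.toBlocks₂₂
    rw [Matrix.fromBlocks_toBlocks, Matrix.fromBlocks_toBlocks] at h
    change (M * N).toBlocks₁₁ = (M * N).toBlocks₂₂ ∧ (M * N).toBlocks₁₂ = (M * N).toBlocks₂₁
    rw [h, Matrix.toBlocks_fromBlocks₁₁, Matrix.toBlocks_fromBlocks₂₂,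
      Matrix.toBlocks_fromBlocks₁₂, Matrix.toBlocks_fromBlocks₂₁, h1, h2, h3, h4]
    exact ⟨add_comm _ _, add_comm _ _⟩

/-- The superalgebra `Q_n(K)`, a sub-superalgebra of `M_{n,n}(K)`. -/
def queerSuperalgebra (K : Type u) [Field K] (n : ℕ) : AssocSuperalgebra.{u, u} K where
  carrier := queerSubalgebra K n
  finiteDimensional :=
    inferInstanceAs (FiniteDimensional K (queerSubalgebra K n).toSubmodule)
  grade := fun i =>
    (matrixGrade K n n i).comap (queerSubalgebra K n).toSubmodule.subtype
  isCompl_grade := by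
    constructor
    · rw [Submodule.disjoint_def]
      intro M h0 h1
      exact Subtype.ext (matrixGrade_disjoint K n n M.1 h0 h1)
    · rw [codisjoint_iff, eq_top_iff]
      rintro ⟨M, hM⟩ _
      obtain ⟨h1, h2⟩ := hM
      rw [Submodule.mem_sup]
      refine ⟨⟨Matrix.fromBlocks M.toBlocks₁₁ 0 0 M.toBlocks₂₂, ?_⟩, ?_,
        ⟨Matrix.fromBlocks 0 M.toBlocks₁₂ M.toBlocks₂₁ 0, ?_⟩, ?_, ?_⟩
      · exact ⟨by simpa using h1, by simp⟩
      · intro a b h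
        change Matrix.fromBlocks M.toBlocks₁₁ 0 0 M.toBlocks₂₂ a b = 0
        rcases a with a | a <;> rcases b with b | b
        · exact absurd rfl h
        · rfl
        · rfl
        · exact absurd (show (1 + 1 : ZMod 2) = 0 by decide) h
      · exact ⟨by simp, by simpa using h2⟩
      · intro a b h
        change Matrix.fromBlocks 0 M.toBlocks₁₂ M.toBlocks₂₁ 0 a b = 0
        rcases a with a | a <;> rcases b with b | b
        · rfl
        · exact absurd rfl h
        · exact absurd rfl h
        · rfl
      · refine Subtype.ext ?_
        change Matrix.fromBlocks M.toBlocks₁₁ 0 0 M.toBlocks₂₂ +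
          Matrix.fromBlocks 0 M.toBlocks₁₂ M.toBlocks₂₁ 0 = M
        rw [Matrix.fromBlocks_add]
        simp [Matrix.fromBlocks_toBlocks]
  mul_mem_grade := fun i j M N hM hN => matrixGrade_mul K n n i j M.1 N.1 hM hN

/-- `V` is (isomorphic to) `M_{r,s}(K)` for some `r ≥ 1`, `s ≥ 0`. -/
def IsMatrixSuperalgebra (V : AssocSuperalgebra.{u, v} K) : Prop :=
  ∃ r s : ℕ, 1 ≤ r ∧ V.Isomorphic (matrixSuperalgebra K r s)

/-- `V` is (isomorphic to) `Q_n(K)` for some `n ≥ 1`. -/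
def IsQueerSuperalgebra (V : AssocSuperalgebra.{u, v} K) : Prop :=
  ∃ n : ℕ, 1 ≤ n ∧ V.Isomorphic (queerSuperalgebra K n)

end AssocSuperalgebra

/-- An even-symmetric associative superalgebra `(A, B)`: `B` is an even, supersymmetric,
associative, non-degenerate bilinear form on `A`. -/
structure EvenSymmetricSuperalgebra (K : Type u) [Field K] extends
    AssocSuperalgebra.{u, v} K where
  form : LinearMap.BilinForm K carrier
  form_even : ∀ (i j : ZMod 2) (x y : carrier),
    x ∈ grade i → y ∈ grade j → i ≠ j → form x y = 0
  form_supersymm : ∀ (i j : ZMod 2) (x y : carrier),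
    x ∈ grade i → y ∈ grade j → form x y = AssocSuperalgebra.sgn K (i * j) * form y x
  form_assoc : ∀ x y z : carrier, form (x * y) z = form x (y * z)
  form_nondeg : ∀ x : carrier, (∀ y : carrier, form x y = 0) → x = 0

namespace EvenSymmetricSuperalgebra

variable {K : Type u} [Field K]

instance : CoeSort (EvenSymmetricSuperalgebra.{u, v} K) (Type v) :=
  ⟨fun A => A.carrier⟩

/-- `(A, B)` is the orthogonal direct sum of `(A₁, B₁)` and `(A₂, B₂)`
(up to an isometric isomorphism of superalgebras). -/
def IsOrthogonalSum (A₁ A₂ A : EvenSymmetricSuperalgebra.{u, v} K) : Prop :=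
  ∃ e : (A₁ × A₂) ≃ₗ[K] A,
    (∀ (i : ZMod 2) (x : A₁) (y : A₂),
      e (x, y) ∈ A.grade i ↔ x ∈ A₁.grade i ∧ y ∈ A₂.grade i) ∧
    (∀ (x x' : A₁) (y y' : A₂), e (x, y) * e (x', y') = e (x * x', y * y')) ∧
    ∀ (x x' : A₁) (y y' : A₂),
      A.form (e (x, y)) (e (x', y')) = A₁.form x x' + A₂.form y y'

/-- A context of generalized double extension of `(W, B)` by the superalgebra `V`: even maps
`mu : V → End W`, `lam : V × V → W`, `gam : V × V → V*` subject to compatibility conditions.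
The map `muAdj` is not extra data: it is determined by `mu` and the form of `W`
through `form_mu`. -/
structure ExtensionContext (W : EvenSymmetricSuperalgebra.{u, v} K)
    (V : AssocSuperalgebra.{u, v} K) where
  mu : V →ₗ[K] Module.End K W
  muAdj : V →ₗ[K] Module.End K W
  lam : V →ₗ[K] V →ₗ[K] W
  gam : V →ₗ[K] V →ₗ[K] Module.Dual K V
  mu_even : ∀ (i j : ZMod 2) (a : V) (x : W),
    a ∈ V.grade i → x ∈ W.grade j → mu a x ∈ W.grade (i + j)
  lam_even : ∀ (i j : ZMod 2) (a b : V),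
    a ∈ V.grade i → b ∈ V.grade j → lam a b ∈ W.grade (i + j)
  gam_even : ∀ (i j : ZMod 2) (a b : V),
    a ∈ V.grade i → b ∈ V.grade j → gam a b ∈ V.dualGrade (i + j)
  form_mu : ∀ (i j k : ZMod 2) (a : V) (x y : W),
    a ∈ V.grade i → x ∈ W.grade j → y ∈ W.grade k →
      W.form (mu a x) y = AssocSuperalgebra.sgn K (i * (j + k)) * W.form x (muAdj a y)
  muAdj_mul : ∀ (a : V) (x y : W), muAdj a (x * y) = x * muAdj a y
  muAdj_comm : ∀ (a b : V) (x : W), muAdj b (mu a x) = mu a (muAdj b x)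
  muAdj_comp : ∀ (a b : V) (x : W), muAdj (a * b) x = muAdj b (muAdj a x) - x * lam a b
  muAdj_lam : ∀ a b c : V,
    muAdj c (lam a b) = mu a (lam b c) + lam a (b * c) - lam (a * b) c
  gam_cyclic : ∀ (i j k : ZMod 2) (a b c : V),
    a ∈ V.grade i → b ∈ V.grade j → c ∈ V.grade k →
      gam a b c = AssocSuperalgebra.sgn K (i * (j + k)) * gam b c a
  gam_cocycle : ∀ (i j k l : ZMod 2) (a b c d : V),
    a ∈ V.grade i → b ∈ V.grade j → c ∈ V.grade k → d ∈ V.grade l →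
      - W.form (lam a b) (lam c d)
          + AssocSuperalgebra.sgn K (i * (j + k + l)) * W.form (lam b c) (lam d a) =
        gam (a * b) c d + gam a b (c * d) - gam a (b * c) d
          - AssocSuperalgebra.sgn K (i * (j + k + l)) * gam b c (d * a)

/-- `(A, B)` is (up to an isometric isomorphism of superalgebras) the generalized double extension
`V ⊕ W ⊕ V*` of `W` by `V` by means of the context `c`. The product of `a + x + f` of degree `i`
and `b + y + g` of degree `j` has
* `V`-component `a b`,
* `W`-component `lam a b + x y + mu a y + muAdj b x`,
* `V*`-component `gam a b + φ(x, y) + ν(a, y) + a · g + ν'(x, b) + f ∘ L_b`, where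
  `φ(x, y)(t) = B(x, muAdj t y)`, `ν'(x, b)(t) = B(x, lam b t)`,
  `ν(a, y)(t) = (-1)^i B(y, lam t a)` and `(a · g)(t) = (-1)^(i (j + |t|)) g(t a)`; the latter
  equals `(-1)^i g(t a)`, since `g(t a) = 0` unless `j + |t| = i`. -/
def IsExtensionBy {W : EvenSymmetricSuperalgebra.{u, v} K} {V : AssocSuperalgebra.{u, v} K}
    (c : ExtensionContext W V) (A : EvenSymmetricSuperalgebra.{u, v} K) : Prop :=
  ∃ e : (V × W × Module.Dual K V) ≃ₗ[K] A,
    (∀ (i : ZMod 2) (a : V) (x : W) (f : Module.Dual K V),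
      e (a, x, f) ∈ A.grade i ↔ a ∈ V.grade i ∧ x ∈ W.grade i ∧ f ∈ V.dualGrade i) ∧
    (∀ (i j : ZMod 2) (a b : V) (x y : W) (f g : Module.Dual K V),
      a ∈ V.grade i → x ∈ W.grade i → f ∈ V.dualGrade i →
      b ∈ V.grade j → y ∈ W.grade j → g ∈ V.dualGrade j →
        e (a, x, f) * e (b, y, g) =
          e (a * b,
            c.lam a b + x * y + c.mu a y + c.muAdj b x,
            c.gam a b + W.form x ∘ₗ c.muAdj.flip y
              + AssocSuperalgebra.sgn K i • (W.form y ∘ₗ c.lam.flip a)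
              + AssocSuperalgebra.sgn K i • (g ∘ₗ LinearMap.mulRight K a)
              + W.form x ∘ₗ c.lam b
              + f ∘ₗ LinearMap.mulLeft K b)) ∧
    ∀ (i j : ZMod 2) (a b : V) (x y : W) (f g : Module.Dual K V),
      a ∈ V.grade i → x ∈ W.grade i → f ∈ V.dualGrade i →
      b ∈ V.grade j → y ∈ W.grade j → g ∈ V.dualGrade j →
        A.form (e (a, x, f)) (e (b, y, g)) =
          W.form x y + AssocSuperalgebra.sgn K (i * j) * g a + f b

/-- `(A, B)` is a generalized double extension of `W` by `V`. When `V` is the one-dimensional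
superalgebra with null product in degree `0` (resp. `1`), this is an even (resp. odd) generalized
double extension of `W`. -/
def IsGeneralizedDoubleExtension (W : EvenSymmetricSuperalgebra.{u, v} K)
    (V : AssocSuperalgebra.{u, v} K) (A : EvenSymmetricSuperalgebra.{u, v} K) : Prop :=
  ∃ c : ExtensionContext W V, IsExtensionBy c A

/-- Membership in `𝒪`: the superalgebra `A` is `{0}`, or the one-dimensional algebra with null
product, or some `M_{r,s}(K)` with `r ≥ 1`, `s ≥ 0` (with any even-symmetric structure). -/
def InO (A : EvenSymmetricSuperalgebra.{u, v} K) : Prop :=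
  Subsingleton A ∨ A.toAssocSuperalgebra.IsNullLine 0 ∨
    A.toAssocSuperalgebra.IsMatrixSuperalgebra

/-- The even-symmetric associative superalgebras obtained from finitely many elements of `𝒪` by a
finite sequence of the allowed operations. -/
inductive ObtainedFromO : EvenSymmetricSuperalgebra.{u, v} K → Prop
  | base (A : EvenSymmetricSuperalgebra.{u, v} K) : InO A → ObtainedFromO A
  | orthogonalSum (A₁ A₂ A : EvenSymmetricSuperalgebra.{u, v} K) :
      ObtainedFromO A₁ → ObtainedFromO A₂ → IsOrthogonalSum A₁ A₂ A → ObtainedFromO A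
  | extensionByMatrix (W : EvenSymmetricSuperalgebra.{u, v} K) (V : AssocSuperalgebra.{u, v} K)
      (A : EvenSymmetricSuperalgebra.{u, v} K) :
      ObtainedFromO W → V.IsMatrixSuperalgebra → IsGeneralizedDoubleExtension W V A →
        ObtainedFromO A
  | extensionByQueer (W : EvenSymmetricSuperalgebra.{u, v} K) (V : AssocSuperalgebra.{u, v} K)
      (A : EvenSymmetricSuperalgebra.{u, v} K) :
      ObtainedFromO W → V.IsQueerSuperalgebra → IsGeneralizedDoubleExtension W V A →
        ObtainedFromO A
  | evenExtension (W : EvenSymmetricSuperalgebra.{u, v} K) (V : AssocSuperalgebra.{u, v} K)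
      (A : EvenSymmetricSuperalgebra.{u, v} K) :
      ObtainedFromO W → V.IsNullLine 0 → IsGeneralizedDoubleExtension W V A →
        ObtainedFromO A
  | oddExtension (W : EvenSymmetricSuperalgebra.{u, v} K) (V : AssocSuperalgebra.{u, v} K)
      (A : EvenSymmetricSuperalgebra.{u, v} K) :
      ObtainedFromO W → V.IsNullLine 1 → IsGeneralizedDoubleExtension W V A →
        ObtainedFromO A

end EvenSymmetricSuperalgebra

/-! The proof is by strong induction on the dimension of `A`.

If `A` has no proper nonzero graded ideal, it lies in `𝒪`. A graded simple superalgebra is a null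
line, some `M_{r,s}(K)` or some `Q_n(K)` (`IsGradedSimple.isNullLine`,
`IsGradedSimple.isMatrix_or_isQueer`), and an even supersymmetric non-degenerate form excludes
`Q_n(K)` and the odd null line.

Otherwise let `I` be a minimal nonzero graded ideal. Its orthogonal `I^⊥` is again a graded ideal,
so by minimality `I ∩ I^⊥` is `0` or `I`. In the first case `A = I ⊕ I^⊥` is an orthogonal direct
sum of smaller algebras. In the second case `I` is isotropic, and `A` is a generalized double
extension of `W = I^⊥/I` by `V = A/I^⊥`, with `I` in the role of `V*`. Graded ideals of `V`
correspond through orthogonals to graded ideals inside `I`, so `V` is graded simple and the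
classification says which of the allowed extensions occurs.

Instead of quotients the proof uses complements inside `A`. Adjoint idempotents `e`, `f` with `e f =
f e = 0` and range of `e` equal to `I` (`exists_isotropicSplitting`) realize `V` on the range of `f`
and `W` on the range of `1 - e - f`. The maps of the context are then components of products in `A`,
and their identities come from associativity of the product and invariance of the form. -/

namespace AssocSuperalgebra

variable {K : Type u} [Field K]

/-! ### Signs and the parity automorphism -/

theorem sgn_zero : sgn K 0 = 1 := by simp [sgn]

theorem sgn_one : sgn K 1 = -1 := by simp [sgn, ZMod.val_one]

theorem sgn_add (i j : ZMod 2) : sgn K (i + j) = sgn K i * sgn K j := by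
  have h2 : (1 + 1 : ZMod 2) = 0 := by decide
  have h (i : ZMod 2) : i = 0 ∨ i = 1 := by revert i; decide
  rcases h i with rfl | rfl <;> rcases h j with rfl | rfl <;> simp [sgn_zero, sgn_one, h2]

theorem sgn_injective [CharZero K] : Function.Injective (sgn K) := by
  have h (i : ZMod 2) : i = 0 ∨ i = 1 := by revert i; decide
  have h1 : (1 : K) ≠ -1 := by
    intro h
    have : (2 : K) = 0 := by linear_combination h
    exact two_ne_zero this
  intro i j hij
  rcases h i with rfl | rfl <;> rcases h j with rfl | rfl <;> simp_all [sgn_zero, sgn_one]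

variable (A : AssocSuperalgebra.{u, v} K)

/-- The parity automorphism, equal to `(-1) ^ i` in degree `i`. -/
noncomputable def parity : A →ₗ[K] A :=
  (A.grade 0).projection (A.grade 1) A.isCompl_grade
    - (A.grade 1).projection (A.grade 0) A.isCompl_grade.symm

variable {A}

theorem parity_of_mem {i : ZMod 2} {x : A} (hx : x ∈ A.grade i) : A.parity x = sgn K i • x := by
  fin_cases i
  · change x ∈ A.grade 0 at hx
    change _ = sgn K 0 • x
    rw [parity, LinearMap.sub_apply, Submodule.projection_apply_of_mem_left _ hx,
      Submodule.projection_apply_of_mem_right _ hx, sgn_zero, sub_zero, one_smul]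
  · change x ∈ A.grade 1 at hx
    change _ = sgn K 1 • x
    rw [parity, LinearMap.sub_apply, Submodule.projection_apply_of_mem_left _ hx,
      Submodule.projection_apply_of_mem_right _ hx, sgn_one, zero_sub, neg_smul, one_smul]

theorem exists_eq_add (x : A) : ∃ y ∈ A.grade 0, ∃ z ∈ A.grade 1, x = y + z := by
  have h : x ∈ A.grade 0 ⊔ A.grade 1 := by rw [A.isCompl_grade.sup_eq_top]; trivial
  obtain ⟨y, hy, z, hz, rfl⟩ := Submodule.mem_sup.1 h
  exact ⟨y, hy, z, hz, rfl⟩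

theorem parity_add_of_mem {y z : A} (hy : y ∈ A.grade 0) (hz : z ∈ A.grade 1) :
    A.parity (y + z) = y - z := by
  rw [map_add, parity_of_mem hy, parity_of_mem hz, sgn_zero, sgn_one, one_smul, neg_smul,
    one_smul, sub_eq_add_neg]

/-- Having degree `i` becomes a linear equation. A map that commutes with `parity` therefore
preserves degrees, and evenness is handled below without homogeneous elements. -/
theorem mem_grade_iff [CharZero K] {i : ZMod 2} {x : A} :
    x ∈ A.grade i ↔ A.parity x = sgn K i • x := by
  refine ⟨parity_of_mem, fun h => ?_⟩
  obtain ⟨y, hy, z, hz, rfl⟩ := A.exists_eq_add x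
  rw [parity_add_of_mem hy hz] at h
  have h2 : (2 : K) ≠ 0 := two_ne_zero
  fin_cases i
  · change y - z = sgn K 0 • (y + z) at h
    rw [sgn_zero, one_smul] at h
    have : (2 : K) • z = 0 := by
      rwa [two_smul, ← left_eq_add, ← add_assoc, ← sub_eq_iff_eq_add]
    rw [(smul_eq_zero.1 this).resolve_left h2, add_zero]
    exact hy
  · change y - z = sgn K 1 • (y + z) at h
    rw [sgn_one, neg_smul, one_smul] at h
    have : (2 : K) • y = 0 := by
      rwa [sub_eq_iff_eq_add, neg_add, neg_add_cancel_right, eq_neg_iff_add_eq_zero,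
        ← two_smul K] at h
    rw [(smul_eq_zero.1 this).resolve_left h2, zero_add]
    exact hz

theorem mem_grade_zero_iff [CharZero K] {x : A} : x ∈ A.grade 0 ↔ A.parity x = x := by
  rw [mem_grade_iff, sgn_zero, one_smul]

@[simp]
theorem parity_parity (x : A) : A.parity (A.parity x) = x := by
  obtain ⟨y, hy, z, hz, rfl⟩ := A.exists_eq_add x
  rw [parity_add_of_mem hy hz, sub_eq_add_neg, parity_add_of_mem hy (neg_mem hz), sub_neg_eq_add]

theorem parity_mul (x y : A) : A.parity (x * y) = A.parity x * A.parity y := by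
  have key (i j : ZMod 2) (a b : A) (ha : a ∈ A.grade i) (hb : b ∈ A.grade j) :
      A.parity (a * b) = A.parity a * A.parity b := by
    rw [parity_of_mem ha, parity_of_mem hb, parity_of_mem (A.mul_mem_grade i j a b ha hb),
      sgn_add, smul_mul_smul_comm]
  obtain ⟨a, ha, b, hb, rfl⟩ := A.exists_eq_add x
  obtain ⟨c, hc, d, hd, rfl⟩ := A.exists_eq_add y
  simp only [add_mul, mul_add, map_add, key 0 0 a c ha hc, key 0 1 a d ha hd, key 1 0 b c hb hc,
    key 1 1 b d hb hd]

/-- The components of `x` are the halves of `x + τ x` and `x - τ x`. -/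
theorem isCompl_of_parity [CharZero K] {E : Type*} [AddCommGroup E] [Module K E]
    (τ : E →ₗ[K] E) (hτ : ∀ x, τ (τ x) = x) (g : ZMod 2 → Submodule K E)
    (hg : ∀ i x, x ∈ g i ↔ τ x = sgn K i • x) : IsCompl (g 0) (g 1) := by
  have h2 : (2 : K) ≠ 0 := two_ne_zero
  constructor
  · rw [Submodule.disjoint_def]
    intro x h0 h1
    rw [hg] at h0 h1
    rw [h0, sgn_zero, sgn_one, one_smul, neg_smul, one_smul] at h1
    have : (2 : K) • x = 0 := by
      rwa [eq_neg_iff_add_eq_zero, ← two_smul K] at h1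
    exact (smul_eq_zero.1 this).resolve_left h2
  · rw [codisjoint_iff, eq_top_iff]
    intro x _
    rw [Submodule.mem_sup]
    refine ⟨(2⁻¹ : K) • (x + τ x), ?_, (2⁻¹ : K) • (x - τ x), ?_, ?_⟩
    · rw [hg, map_smul, map_add, hτ, sgn_zero, one_smul, add_comm]
    · rw [hg, map_smul, map_sub, hτ, sgn_one, neg_smul, one_smul, ← smul_neg, neg_sub]
    · rw [← smul_add, add_add_sub_cancel, ← two_smul K x, smul_smul, inv_mul_cancel₀ h2, one_smul]

/-! ### Graded ideals and compression to the range of an idempotent -/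

/-- A graded two-sided ideal. -/
structure IsGradedIdeal (A : AssocSuperalgebra.{u, v} K) (I : Submodule K A) : Prop where
  mul_mem_left : ∀ a x : A, x ∈ I → a * x ∈ I
  mul_mem_right : ∀ a x : A, x ∈ I → x * a ∈ I
  parity_mem : ∀ x ∈ I, A.parity x ∈ I

/-- `A` has no graded two-sided ideals besides `0` and `A`. -/
def IsGradedSimple (A : AssocSuperalgebra.{u, v} K) : Prop :=
  ∀ I : Submodule K A, A.IsGradedIdeal I → I = ⊥ ∨ I = ⊤

/-- `V` is realized on the image of the idempotent `π`, with product the image under `π` of the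
product of `A`. -/
structure Compression (A V : AssocSuperalgebra.{u, v} K) (π : A →ₗ[K] A) where
  incl : V →ₗ[K] A
  proj : A →ₗ[K] V
  proj_incl : ∀ x, proj (incl x) = x
  incl_proj : ∀ y, incl (proj y) = π y
  mul_eq : ∀ x y, x * y = proj (incl x * incl y)
  mem_grade : ∀ i x, x ∈ V.grade i ↔ incl x ∈ A.grade i

/-- The hypotheses `hl` and `hr` are what makes the compressed product associative: an inner `π` may
be dropped under an outer one. This serves the three constructions below: the quotient `A/I^⊥`, the
subquotient `I^⊥/I`, and an orthogonal summand. -/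
theorem exists_compression [CharZero K] (A : AssocSuperalgebra.{u, v} K) (π : A →ₗ[K] A)
    (hπ : ∀ x, π (π x) = π x) (hσ : ∀ x, π (A.parity x) = A.parity (π x))
    (hl : ∀ x y z, π (π (π x * π y) * π z) = π (π x * π y * π z))
    (hr : ∀ x y z, π (π x * π (π y * π z)) = π (π x * (π y * π z))) :
    ∃ V : AssocSuperalgebra.{u, v} K, Nonempty (Compression A V π) := by
  let E := LinearMap.range π
  let s : E →ₗ[K] A := E.subtype
  let p : A →ₗ[K] E := π.rangeRestrict
  have hs (x : E) : π (s x) = s x := by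
    obtain ⟨_, y, rfl⟩ := x
    exact hπ y
  have hsp (y : A) : s (p y) = π y := rfl
  have hps (x : E) : p (s x) = x := Subtype.ext (hs x)
  let R : NonUnitalRing E :=
    { (inferInstance : AddCommGroup E) with
      mul := fun x y => p (s x * s y)
      left_distrib := fun x y z => by
        change p (s x * s (y + z)) = p (s x * s y) + p (s x * s z)
        rw [map_add, mul_add, map_add]
      right_distrib := fun x y z => by
        change p (s (x + y) * s z) = p (s x * s z) + p (s y * s z)
        rw [map_add, add_mul, map_add]
      zero_mul := fun x => by
        change p (s 0 * s x) = 0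
        rw [map_zero, zero_mul, map_zero]
      mul_zero := fun x => by
        change p (s x * s 0) = 0
        rw [map_zero, mul_zero, map_zero]
      mul_assoc := fun x y z => by
        refine Subtype.ext ?_
        change π (π (s x * s y) * s z) = π (s x * π (s y * s z))
        have h1 := hl (s x) (s y) (s z)
        have h2 := hr (s x) (s y) (s z)
        rw [hs, hs, hs] at h1 h2
        rw [h1, h2, mul_assoc] }
  let V : AssocSuperalgebra.{u, v} K :=
    { carrier := E
      nonUnitalRing := R
      module := inferInstanceAs (Module K E)
      isScalarTower := ⟨fun c x y => by
        change p (s (c • x) * s y) = c • p (s x * s y)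
        rw [map_smul, smul_mul_assoc, map_smul]⟩
      smulCommClass := ⟨fun c x y => by
        change c • p (s x * s y) = p (s x * s (c • y))
        rw [map_smul, mul_smul_comm, map_smul]⟩
      finiteDimensional := inferInstanceAs (FiniteDimensional K E)
      grade := fun i => (A.grade i).comap s
      isCompl_grade := by
        refine isCompl_of_parity (p ∘ₗ A.parity ∘ₗ s) (fun x => ?_)
          (fun i => (A.grade i).comap s) fun i x => ?_
        · change p (A.parity (π (A.parity (s x)))) = x
          rw [← hσ, parity_parity, hs, hps]
        · rw [Submodule.mem_comap, mem_grade_iff]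
          change _ ↔ p (A.parity (s x)) = _
          constructor
          · intro h
            rw [h, map_smul, hps]
          · intro h
            have := congrArg s h
            rwa [hsp, hσ, hs, map_smul] at this
      mul_mem_grade := fun i j x y hx hy => by
        change π (s x * s y) ∈ A.grade (i + j)
        have := A.mul_mem_grade i j _ _ hx hy
        rw [mem_grade_iff] at this ⊢
        rw [← hσ, this, map_smul] }
  exact ⟨V, ⟨⟨s, p, hps, hsp, fun _ _ => rfl, fun _ _ => Iff.rfl⟩⟩⟩

namespace Compression

variable {V : AssocSuperalgebra.{u, v} K} {π : A →ₗ[K] A} (c : Compression A V π)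
include c

theorem incl_injective : Function.Injective c.incl := fun x y h => by
  rw [← c.proj_incl x, h, c.proj_incl]

theorem apply_incl (x : V) : π (c.incl x) = c.incl x := by
  rw [← c.incl_proj, c.proj_incl]

theorem proj_apply (y : A) : c.proj (π y) = c.proj y := by
  rw [← c.incl_proj, c.proj_incl]

theorem proj_eq_zero {y : A} : c.proj y = 0 ↔ π y = 0 := by
  rw [← c.incl_proj, map_eq_zero_iff _ c.incl_injective]

theorem incl_parity [CharZero K] (x : V) : c.incl (V.parity x) = A.parity (c.incl x) := by
  obtain ⟨y, hy, z, hz, rfl⟩ := V.exists_eq_add x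
  rw [parity_add_of_mem hy hz, map_add, map_sub,
    parity_add_of_mem ((c.mem_grade 0 y).1 hy) ((c.mem_grade 1 z).1 hz)]

theorem proj_mem_grade [CharZero K] (hσ : ∀ x, π (A.parity x) = A.parity (π x))
    {i : ZMod 2} {y : A} (hy : y ∈ A.grade i) : c.proj y ∈ V.grade i := by
  rw [c.mem_grade, c.incl_proj]
  rw [mem_grade_iff] at hy ⊢
  rw [← hσ, hy, map_smul]

theorem finrank_lt {y : A} (hy : y ≠ 0) (h : π y = 0) :
    Module.finrank K V < Module.finrank K A := by
  have h1 := LinearMap.finrank_range_add_finrank_ker c.proj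
  have h2 : Module.finrank K (LinearMap.range c.proj) = Module.finrank K V := by
    rw [LinearMap.range_eq_top.2 fun x => ⟨_, c.proj_incl x⟩, finrank_top]
  have h3 : 0 < Module.finrank K (LinearMap.ker c.proj) := by
    rw [Module.finrank_pos_iff]
    exact ⟨⟨⟨y, by rw [LinearMap.mem_ker, c.proj_eq_zero, h]⟩, 0, fun h' => hy congr($h')⟩⟩
  omega

end Compression

/-- The data of a superalgebra isomorphism need only be checked on homogeneous elements in one
direction. -/
theorem isomorphic_of_mem_grade {A' : AssocSuperalgebra.{u, w} K} (e : A ≃ₗ[K] A')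
    (hmul : ∀ x y : A, e (x * y) = e x * e y)
    (h : ∀ (i : ZMod 2) (x : A), x ∈ A.grade i → e x ∈ A'.grade i) : A.Isomorphic A' := by
  refine ⟨e, hmul, fun i x => ⟨fun hx => ?_, h i x⟩⟩
  obtain ⟨y, hy, z, hz, rfl⟩ := A.exists_eq_add x
  have hy' := h 0 y hy
  have hz' := h 1 z hz
  rw [map_add] at hx
  fin_cases i
  · have hz0 : e z ∈ A'.grade 0 := by
      have := sub_mem (show e y + e z ∈ A'.grade 0 from hx) hy'
      rwa [add_sub_cancel_left] at this
    have := Submodule.disjoint_def.1 A'.isCompl_grade.disjoint _ hz0 hz'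
    rw [e.map_eq_zero_iff.1 this, add_zero]
    exact hy
  · have hy1 : e y ∈ A'.grade 1 := by
      have := sub_mem (show e y + e z ∈ A'.grade 1 from hx) hz'
      rwa [add_sub_cancel_right] at this
    have := Submodule.disjoint_def.1 A'.isCompl_grade.disjoint _ hy' hy1
    rw [e.map_eq_zero_iff.1 this, zero_add]
    exact hz

/-- When all products vanish, the line through any homogeneous vector is a graded ideal. -/
theorem IsGradedSimple.isNullLine [CharZero K] [Nontrivial A] (hA : A.IsGradedSimple)
    (h0 : ∀ x y : A, x * y = 0) : A.IsNullLine 0 ∨ A.IsNullLine 1 := by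
  have key (i : ZMod 2) (x : A) (hx : x ∈ A.grade i) (hx0 : x ≠ 0) : A.IsNullLine i := by
    have htop : K ∙ x = ⊤ := by
      refine (hA (K ∙ x) ⟨fun a y _ => ?_, fun a y _ => ?_, fun y hy => ?_⟩).resolve_left ?_
      · rw [h0]; exact zero_mem _
      · rw [h0]; exact zero_mem _
      · obtain ⟨c, rfl⟩ := Submodule.mem_span_singleton.1 hy
        rw [map_smul, parity_of_mem hx]
        exact Submodule.smul_mem _ _ (Submodule.smul_mem _ _ (Submodule.mem_span_singleton_self x))
      · rwa [Submodule.span_singleton_eq_bot]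
    refine ⟨?_, ?_, h0⟩
    · rw [← finrank_top, ← htop, finrank_span_singleton hx0]
    · rw [eq_top_iff, ← htop, Submodule.span_singleton_le_iff_mem]
      exact hx
  obtain ⟨x, hx⟩ := exists_ne (0 : A)
  obtain ⟨y, hy, z, hz, rfl⟩ := A.exists_eq_add x
  by_cases hy0 : y = 0
  · exact Or.inr (key 1 z hz (by rintro rfl; exact hx (by rw [hy0, add_zero])))
  · exact Or.inl (key 0 y hy hy0)

end AssocSuperalgebra

/-! ### Burnside's theorem and the classification of graded simple superalgebras -/

/-- Burnside's theorem for spaces of endomorphisms that are closed under composition. -/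
theorem Module.End.eq_top_of_transitive {K : Type*} {P : Type*} [Field K] [IsAlgClosed K]
    [AddCommGroup P] [Module K P] [FiniteDimensional K P] (E : Submodule K (Module.End K P))
    (hmul : ∀ f ∈ E, ∀ g ∈ E, f * g ∈ E)
    (htr : ∀ p : P, p ≠ 0 → ∀ q : P, ∃ f ∈ E, f p = q) : E = ⊤ := by
  classical
  rcases subsingleton_or_nontrivial P with hP | hP
  · exact Subsingleton.elim _ _
  let R : Subalgebra K (Module.End K P) := Algebra.adjoin K (E : Set (Module.End K P))
  have hsimple : IsSimpleModule R P := by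
    refine isSimpleModule_iff_toSpanSingleton_surjective.2 ⟨hP, fun p hp q => ?_⟩
    obtain ⟨f, hf, hfp⟩ := htr p hp q
    exact ⟨⟨f, Algebra.subset_adjoin hf⟩, hfp⟩
  have hR (f : Module.End K P) : f ∈ R := by
    -- By Schur's lemma the commutant of `R` consists of scalars, so every `K`-linear `f` commutes
    -- with it and Jacobson density finds an element of `R` equal to `f` on a basis.
    let F : Module.End (Module.End R P) P :=
      { toFun := f
        map_add' := map_add f
        map_smul' := fun g x => by
          obtain ⟨c, rfl⟩ :=
            (IsSimpleModule.algebraMap_end_bijective_of_isAlgClosed (A := R) (V := P) K).2 g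
          exact map_smul f c x }
    let b := Module.finBasis K P
    obtain ⟨r, hr⟩ := jacobson_density F (Finset.univ.image b)
    have : f = r.1 := b.ext fun i => hr (b i) (Finset.mem_image_of_mem _ (Finset.mem_univ i))
    rw [this]
    exact r.2
  -- `E` need not contain the identity a priori, whereas `R` does. What descends from `R = End P` to
  -- `E` is that `E` is a right ideal of `End P`.
  have hE (g : Module.End K P) : ∀ f ∈ E, f * g ∈ E := by
    have hg := hR g
    induction hg using Algebra.adjoin_induction with
    | mem g hg => exact fun f hf => hmul f hf g hg
    | algebraMap c =>
      intro f hf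
      rw [← Algebra.commutes, ← Algebra.smul_def]
      exact E.smul_mem c hf
    | add g h _ _ hg hh =>
      intro f hf
      rw [mul_add]
      exact E.add_mem (hg f hf) (hh f hf)
    | mul g h _ _ hg hh =>
      intro f hf
      rw [← mul_assoc]
      exact hh _ (hg f hf)
  obtain ⟨p, hp⟩ := exists_ne (0 : P)
  refine eq_top_iff.2 fun f _ => ?_
  let b := Module.finBasis K P
  have hf : f = ∑ i, (b.coord i).smulRight (f (b i)) := by
    refine b.ext fun j => ?_
    simp [Finsupp.single_apply]
  rw [hf]
  refine E.sum_mem fun i _ => ?_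
  -- Each rank-one summand of `f` factors as an element `X` of `E` after a rank-one map with values
  -- in the line of `p`, so it lies in the right ideal `E`.
  obtain ⟨X, hX, hXp⟩ := htr p hp (f (b i))
  have : (b.coord i).smulRight (f (b i)) = X * (b.coord i).smulRight p := by
    ext x
    simp [hXp]
  rw [this]
  exact hE _ X hX

namespace AssocSuperalgebra

variable {K : Type u} [Field K]

/-- The elements killed by all left multiplications form a graded ideal, which is not everything
because some product is nonzero. It replaces a unit: it gives `V p ≠ 0` for `p ≠ 0`. -/
theorem IsGradedSimple.eq_zero_of_left_mul {V : AssocSuperalgebra.{u, v} K} (hV : V.IsGradedSimple)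
    (h0 : ∃ x y : V, x * y ≠ 0) (y : V) (hy : ∀ x : V, x * y = 0) : y = 0 := by
  let I : Submodule K V :=
    { carrier := {y | ∀ x : V, x * y = 0}
      add_mem' := fun ha hb x => by rw [mul_add, ha x, hb x, add_zero]
      zero_mem' := fun x => mul_zero x
      smul_mem' := fun c a ha x => by rw [mul_smul_comm, ha x, smul_zero] }
  have hI : V.IsGradedIdeal I :=
    ⟨fun a x hx z => by rw [hx a, mul_zero], fun a x hx z => by rw [← mul_assoc, hx z, zero_mul],
      fun x hx z => by rw [← parity_parity z, ← parity_mul, hx, map_zero]⟩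
  rcases hV I hI with h | h
  · exact (Submodule.eq_bot_iff I).1 h y hy
  · obtain ⟨a, b, hab⟩ := h0
    have hb : b ∈ I := by rw [h]; trivial
    exact absurd (hb a) hab

/-- A graded simple superalgebra with nonzero product acts by all endomorphisms on some nonzero
vector space. -/
theorem IsGradedSimple.exists_surjective [IsAlgClosed K] {V : AssocSuperalgebra.{u, v} K}
    (hV : V.IsGradedSimple) (h0 : ∃ x y : V, x * y ≠ 0) :
    ∃ (P : Submodule K V) (L : V →ₗ[K] Module.End K P), Nontrivial P ∧
      (∀ x y, L (x * y) = L x * L y) ∧ Function.Surjective L := by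
  -- `P` is a minimal nonzero left ideal, deliberately not required to be graded. Transitivity holds
  -- because `V p` is a nonzero left ideal inside `P`, for every nonzero `p` in `P`.
  let S : Set (Submodule K V) := {P | P ≠ ⊥ ∧ ∀ a : V, ∀ x ∈ P, a * x ∈ P}
  have hS : S.Nonempty := by
    obtain ⟨x, y, hxy⟩ := h0
    refine ⟨⊤, fun h => hxy ?_, fun _ _ _ => trivial⟩
    exact (Submodule.eq_bot_iff _).1 h _ trivial
  obtain ⟨P, ⟨hP, hPm⟩, hmin⟩ := WellFounded.has_min (wellFounded_lt (α := Submodule K V)) S hS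
  let L : V →ₗ[K] Module.End K P :=
    LinearMap.mk₂ K (fun a x => (⟨a * x.1, hPm a x.1 x.2⟩ : P))
      (fun a b x => Subtype.ext (add_mul a b x.1))
      (fun c a x => Subtype.ext (smul_mul_assoc c a x.1))
      (fun a x y => Subtype.ext (mul_add a x.1 y.1))
      (fun c a x => Subtype.ext (mul_smul_comm c a x.1))
  have hL (a : V) (x : P) : (L a x : V) = a * x := rfl
  have hLmul (x y : V) : L (x * y) = L x * L y := by
    ext z
    exact mul_assoc x y z.1
  refine ⟨P, L, (Submodule.nontrivial_iff_ne_bot).2 hP, hLmul, LinearMap.range_eq_top.1 ?_⟩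
  refine Module.End.eq_top_of_transitive _ ?_ fun p hp q => ?_
  · rintro _ ⟨x, rfl⟩ _ ⟨y, rfl⟩
    exact ⟨x * y, hLmul x y⟩
  · let Q : Submodule K V := LinearMap.range (LinearMap.mulRight K p.1)
    have hQ : Q ∈ S := by
      constructor
      · intro h
        refine hp (Subtype.ext (hV.eq_zero_of_left_mul h0 _ fun x => ?_))
        exact (Submodule.eq_bot_iff Q).1 h _ ⟨x, rfl⟩
      · rintro a _ ⟨x, rfl⟩
        exact ⟨a * x, mul_assoc _ _ _⟩
    have hQP : Q ≤ P := by
      rintro _ ⟨x, rfl⟩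
      exact hPm x _ p.2
    have : Q = P := by
      by_contra hne
      exact hmin Q hQ (lt_of_le_of_ne hQP hne)
    have hq : q.1 ∈ Q := by rw [this]; exact q.2
    obtain ⟨x, hx⟩ := hq
    exact ⟨L x, ⟨x, rfl⟩, Subtype.ext hx⟩

/-- A space with an involution has a basis of eigenvectors, labelled by their eigenvalues. -/
theorem exists_basis_of_involution [CharZero K] {P : Type*} [AddCommGroup P] [Module K P]
    [FiniteDimensional K P] (T : P →ₗ[K] P) (hT : ∀ x, T (T x) = x) (h1 : ∃ x, T x = x ∧ x ≠ 0) :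
    ∃ (r s : ℕ) (b : Module.Basis (Fin r ⊕ Fin s) K P), 1 ≤ r ∧
      ∀ i, T (b i) = sgn K (blockParity r s i) • b i := by
  let g : ZMod 2 → Submodule K P := fun i => LinearMap.ker (T - sgn K i • LinearMap.id)
  have hg (i : ZMod 2) (x : P) : x ∈ g i ↔ T x = sgn K i • x := by
    rw [LinearMap.mem_ker, LinearMap.sub_apply, sub_eq_zero, LinearMap.smul_apply,
      LinearMap.id_apply]
  have hc : IsCompl (g 0) (g 1) := isCompl_of_parity T hT g hg
  let b : Module.Basis (Fin _ ⊕ Fin _) K P :=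
    ((Module.finBasis K (g 0)).prod (Module.finBasis K (g 1))).map
      (Submodule.prodEquivOfIsCompl _ _ hc)
  refine ⟨_, _, b, ?_, ?_⟩
  · obtain ⟨x, hx, hx0⟩ := h1
    have hx' : x ∈ g 0 := by rw [hg, hx, sgn_zero, one_smul]
    change 0 < Module.finrank K (g 0)
    rw [Module.finrank_pos_iff]
    exact ⟨⟨⟨x, hx'⟩, 0, fun h => hx0 congr($h)⟩⟩
  · rintro (i | i)
    · have : b (Sum.inl i) = (Module.finBasis K (g 0) i : P) := by simp [b]
      rw [this]
      exact (hg 0 _).1 (Module.finBasis K (g 0) i).2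
    · have : b (Sum.inr i) = (Module.finBasis K (g 1) i : P) := by simp [b]
      rw [this]
      exact (hg 1 _).1 (Module.finBasis K (g 1) i).2

/-- By Skolem–Noether the parity of `V` becomes conjugation by some `T` on `P`. Since parity is an
involution, `T²` is central, hence a scalar, and `T` can be rescaled to an involution. Its
eigenspaces give the two blocks. -/
theorem isMatrixSuperalgebra_of_linearEquiv [CharZero K] [IsAlgClosed K]
    {V : AssocSuperalgebra.{u, v} K} {P : Type v} [AddCommGroup P] [Module K P]
    [FiniteDimensional K P] [Nontrivial P] (L : V ≃ₗ[K] Module.End K P)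
    (hL : ∀ x y, L (x * y) = L x * L y) : V.IsMatrixSuperalgebra := by
  -- transport of the parity to `End P`
  have hone : V.parity (L.symm 1) = L.symm 1 := by
    have hl (x : V) : L.symm 1 * x = x := L.injective (by rw [hL, L.apply_symm_apply, one_mul])
    have hr (x : V) : x * L.symm 1 = x := L.injective (by rw [hL, L.apply_symm_apply, mul_one])
    have := congrArg V.parity (hl (V.parity (L.symm 1)))
    rwa [parity_mul, parity_parity, hr] at this
  let σ : Module.End K P ≃ₐ[K] Module.End K P :=
    AlgEquiv.ofLinearEquiv
      (L.symm.trans ((LinearEquiv.ofInvolutive V.parity parity_parity).trans L))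
      (by
        change L (V.parity (L.symm 1)) = 1
        rw [hone, L.apply_symm_apply])
      (fun f g => by
        change L (V.parity (L.symm (f * g))) = L (V.parity (L.symm f)) * L (V.parity (L.symm g))
        have : L.symm (f * g) = L.symm f * L.symm g := L.injective (by simp [hL])
        rw [this, parity_mul, hL])
  obtain ⟨T, hT⟩ := σ.eq_linearEquivConjAlgEquiv
  have hT1 (x : V) (p : P) : L (V.parity x) (T p) = T (L x p) := by
    have h1 : L (V.parity x) = σ (L x) := by
      change _ = L (V.parity (L.symm (L x)))
      rw [L.symm_apply_apply]
    rw [h1, hT]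
    simp [LinearEquiv.conjAlgEquiv_apply]
  -- the square of `T` is a scalar
  obtain ⟨c, hc⟩ : ∃ c : K, ∀ p, T (T p) = c • p := by
    have hcomm : (T.toLinearMap ∘ₗ T.toLinearMap : Module.End K P) ∈
        Subalgebra.center K (Module.End K P) := by
      rw [Subalgebra.mem_center_iff]
      intro f
      ext p
      obtain ⟨x, rfl⟩ := L.surjective f
      change L x (T (T p)) = T (T (L x p))
      rw [← hT1, ← hT1, parity_parity]
    rw [Algebra.IsCentral.center_eq_bot, Algebra.mem_bot] at hcomm
    obtain ⟨c, hc⟩ := hcomm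
    exact ⟨c, fun p => (congr($hc p)).symm⟩
  have hc0 : c ≠ 0 := by
    rintro rfl
    obtain ⟨p, hp⟩ := exists_ne (0 : P)
    have := hc p
    rw [zero_smul] at this
    simp [hp] at this
  obtain ⟨d, hd⟩ := IsAlgClosed.exists_pow_nat_eq c (n := 2) two_pos
  have hd0 : d ≠ 0 := by
    rintro rfl
    exact hc0 (by rw [← hd]; simp)
  have hinv (ε : K) (hε : ε * ε * c = 1) :
      ∀ p, (ε • T.toLinearMap) ((ε • T.toLinearMap) p) = p := by
    intro p
    simp only [LinearMap.smul_apply, LinearEquiv.coe_coe, map_smul, hc, smul_smul, ← mul_assoc, hε,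
      one_smul]
  have hdd : d⁻¹ * d⁻¹ * c = 1 := by
    rw [← hd]
    field_simp
  -- a sign makes the eigenspace of eigenvalue `1` nonzero
  obtain ⟨ε, hε, p, hp, hp0⟩ : ∃ ε : K, ε * ε * c = 1 ∧ ∃ p : P, ε • T p = p ∧ p ≠ 0 := by
    obtain ⟨p, hp⟩ := exists_ne (0 : P)
    by_cases h : p + d⁻¹ • T p = 0
    · refine ⟨-d⁻¹, by rw [neg_mul_neg, hdd], p, ?_, hp⟩
      rw [neg_smul, neg_eq_iff_add_eq_zero, add_comm]
      exact h
    · refine ⟨d⁻¹, hdd, p + d⁻¹ • T p, ?_, h⟩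
      have := hinv _ hdd p
      simp only [LinearMap.smul_apply, LinearEquiv.coe_coe] at this
      rw [map_add, smul_add, this, add_comm]
  obtain ⟨r, s, b, hr, hb⟩ := exists_basis_of_involution (ε • T.toLinearMap) (hinv ε hε)
    ⟨p, hp, hp0⟩
  refine ⟨r, s, hr, ?_⟩
  let e : V ≃ₗ[K] (matrixSuperalgebra K r s) := L.trans (LinearMap.toMatrix b b)
  have he (x : V) (i j) : (e x : Matrix (Fin r ⊕ Fin s) (Fin r ⊕ Fin s) K) i j =
      b.repr (L x (b j)) i := LinearMap.toMatrix_apply _ _ _ _ _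
  refine isomorphic_of_mem_grade e (fun x y => ?_) fun i x hx => ?_
  · change LinearMap.toMatrix b b (L (x * y)) =
      LinearMap.toMatrix b b (L x) * LinearMap.toMatrix b b (L y)
    rw [hL, LinearMap.toMatrix_mul]
  · intro k l hkl
    change (e x : Matrix (Fin r ⊕ Fin s) (Fin r ⊕ Fin s) K) k l = 0
    rw [he]
    have hcoord (q : P) : b.repr (ε • T q) k = sgn K (blockParity r s k) * b.repr q k := by
      have : (b.coord k) ∘ₗ (ε • T.toLinearMap) = sgn K (blockParity r s k) • b.coord k := by
        refine b.ext fun j => ?_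
        rw [LinearMap.comp_apply, hb, map_smul, LinearMap.smul_apply]
        by_cases hjk : j = k
        · rw [hjk]
        · simp [hjk]
      exact congr($this q)
    have h1 := hcoord (L x (b l))
    rw [← hT1, parity_of_mem hx, L.map_smul, LinearMap.smul_apply, smul_comm ε,
      ← map_smul (L x)] at h1
    have h2 := hb l
    rw [LinearMap.smul_apply, LinearEquiv.coe_coe] at h2
    rw [h2, map_smul (L x), smul_smul, map_smul, Finsupp.smul_apply, smul_eq_mul, ← sgn_add] at h1
    -- A nonzero entry in position `(k, l)` allows cancellation in `h1`, which forces `i` to be the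
    -- sum of the parities of `k` and `l`.
    by_contra h0
    have h3 := sgn_injective (mul_right_cancel₀ h0 h1)
    apply hkl
    rw [← h3]
    have h4 (i m : ZMod 2) : i + m + m = i := by
      revert i m
      decide
    exact h4 _ _

/-- Let `N` be the kernel of `L`, a nonzero ideal. Both `N ∩ parity N` and `N + parity N` are graded
ideals, so they are `0` and `V`. Thus `V` is `End P × End P` with the factors exchanged by parity,
which is `Q_n(K)`. -/
theorem isQueerSuperalgebra_of_surjective [CharZero K] {V : AssocSuperalgebra.{u, v} K}
    (hV : V.IsGradedSimple) {P : Type v} [AddCommGroup P] [Module K P]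
    [FiniteDimensional K P] [Nontrivial P] (L : V →ₗ[K] Module.End K P)
    (hL : ∀ x y, L (x * y) = L x * L y) (hsurj : Function.Surjective L)
    (hker : ∃ x, L x = 0 ∧ x ≠ 0) : V.IsQueerSuperalgebra := by
  have h2 : (2 : K) ≠ 0 := two_ne_zero
  -- elements killed by `L` and by `L ∘ parity`
  have hinj (x : V) (h1 : L x = 0) (h1' : L (V.parity x) = 0) : x = 0 := by
    let I : Submodule K V := LinearMap.ker L ⊓ LinearMap.ker (L ∘ₗ V.parity)
    have hI : V.IsGradedIdeal I := by
      refine ⟨?_, ?_, ?_⟩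
      · rintro a x ⟨hx, hx'⟩
        rw [SetLike.mem_coe, LinearMap.mem_ker] at hx hx'
        rw [LinearMap.comp_apply] at hx'
        constructor
        · rw [SetLike.mem_coe, LinearMap.mem_ker, hL, hx, mul_zero]
        · rw [SetLike.mem_coe, LinearMap.mem_ker, LinearMap.comp_apply, parity_mul, hL, hx',
            mul_zero]
      · rintro a x ⟨hx, hx'⟩
        rw [SetLike.mem_coe, LinearMap.mem_ker] at hx hx'
        rw [LinearMap.comp_apply] at hx'
        constructor
        · rw [SetLike.mem_coe, LinearMap.mem_ker, hL, hx, zero_mul]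
        · rw [SetLike.mem_coe, LinearMap.mem_ker, LinearMap.comp_apply, parity_mul, hL, hx',
            zero_mul]
      · rintro x ⟨hx, hx'⟩
        refine ⟨hx', ?_⟩
        rw [SetLike.mem_coe, LinearMap.mem_ker, LinearMap.comp_apply, parity_parity]
        exact hx
    rcases hV I hI with h | h
    · exact (Submodule.eq_bot_iff I).1 h x ⟨h1, h1'⟩
    · exfalso
      obtain ⟨y, hy⟩ := hsurj 1
      have : y ∈ I := by rw [h]; trivial
      have hy0 : L y = 0 := this.1
      exact one_ne_zero (hy.symm.trans hy0)
  have hdec (x : V) : ∃ y z, L y = 0 ∧ L (V.parity z) = 0 ∧ x = y + z := by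
    let N := LinearMap.ker L
    let N' := LinearMap.ker (L ∘ₗ V.parity)
    have hI : V.IsGradedIdeal (N ⊔ N') := by
      refine ⟨fun a x hx => ?_, fun a x hx => ?_, fun x hx => ?_⟩ <;>
        obtain ⟨y, hy, z, hz, rfl⟩ := Submodule.mem_sup.1 hx <;>
        rw [LinearMap.mem_ker] at hy hz <;> rw [LinearMap.comp_apply] at hz
      · rw [mul_add]
        refine Submodule.add_mem_sup ?_ ?_
        · rw [LinearMap.mem_ker, hL, hy, mul_zero]
        · rw [LinearMap.mem_ker, LinearMap.comp_apply, parity_mul, hL, hz, mul_zero]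
      · rw [add_mul]
        refine Submodule.add_mem_sup ?_ ?_
        · rw [LinearMap.mem_ker, hL, hy, zero_mul]
        · rw [LinearMap.mem_ker, LinearMap.comp_apply, parity_mul, hL, hz, zero_mul]
      · rw [map_add, add_comm]
        refine Submodule.add_mem_sup hz ?_
        rw [LinearMap.mem_ker, LinearMap.comp_apply, parity_parity, hy]
    have htop : N ⊔ N' = ⊤ := by
      refine (hV _ hI).resolve_left fun h => ?_
      obtain ⟨x, hx, hx0⟩ := hker
      exact hx0 ((Submodule.eq_bot_iff _).1 h x (Submodule.mem_sup_left hx))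
    have hx : x ∈ N ⊔ N' := by rw [htop]; trivial
    obtain ⟨y, hy, z, hz, rfl⟩ := Submodule.mem_sup.1 hx
    exact ⟨y, z, hy, hz, rfl⟩
  let n := Module.finrank K P
  let M : V →ₗ[K] Matrix (Fin n) (Fin n) K :=
    (LinearMap.toMatrix (Module.finBasis K P) (Module.finBasis K P)).toLinearMap ∘ₗ L
  have hM0 (x : V) : M x = 0 ↔ L x = 0 :=
    (LinearMap.toMatrix (Module.finBasis K P) (Module.finBasis K P)).map_eq_zero_iff
  have hMmul (x y : V) : M (x * y) = M x * M y := by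
    change LinearMap.toMatrix _ _ (L (x * y)) =
      LinearMap.toMatrix _ _ (L x) * LinearMap.toMatrix _ _ (L y)
    rw [hL, LinearMap.toMatrix_mul]
  have hMsurj : Function.Surjective M :=
    (LinearMap.toMatrix (Module.finBasis K P) (Module.finBasis K P)).surjective.comp hsurj
  -- `α x` and `β x` are the images under `M` of the even and odd parts of `x`.
  let α : V →ₗ[K] Matrix (Fin n) (Fin n) K := (2⁻¹ : K) • (M + M ∘ₗ V.parity)
  let β : V →ₗ[K] Matrix (Fin n) (Fin n) K := (2⁻¹ : K) • (M - M ∘ₗ V.parity)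
  have hα (x : V) : α x = (2⁻¹ : K) • (M x + M (V.parity x)) := rfl
  have hβ (x : V) : β x = (2⁻¹ : K) • (M x - M (V.parity x)) := rfl
  have hαβ (x : V) : M x = α x + β x := by
    rw [hα, hβ]
    module
  have hαβ' (x : V) : M (V.parity x) = α x - β x := by
    rw [hα, hβ]
    module
  have hαmul (x y : V) : α (x * y) = α x * α y + β x * β y := by
    rw [hα (x * y), parity_mul, hMmul, hMmul, hαβ x, hαβ' x, hαβ y, hαβ' y, inv_smul_eq_iff₀ h2,
      two_smul]
    noncomm_ring
  have hβmul (x y : V) : β (x * y) = α x * β y + β x * α y := by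
    rw [hβ (x * y), parity_mul, hMmul, hMmul, hαβ x, hαβ' x, hαβ y, hαβ' y, inv_smul_eq_iff₀ h2,
      two_smul]
    noncomm_ring
  let q : V →ₗ[K] queerSubalgebra K n :=
    { toFun := fun x => ⟨Matrix.fromBlocks (α x) (β x) (β x) (α x), rfl, rfl⟩
      map_add' := fun x y => Subtype.ext (by
        change _ = Matrix.fromBlocks _ _ _ _ + Matrix.fromBlocks _ _ _ _
        rw [Matrix.fromBlocks_add, map_add, map_add])
      map_smul' := fun c x => Subtype.ext (by
        change _ = c • Matrix.fromBlocks _ _ _ _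
        rw [Matrix.fromBlocks_smul, map_smul, map_smul]) }
  have hq (x : V) : (q x).1 = Matrix.fromBlocks (α x) (β x) (β x) (α x) := rfl
  have hqinj : Function.Injective q := by
    rw [injective_iff_map_eq_zero]
    intro x hx
    have h0 : Matrix.fromBlocks (α x) (β x) (β x) (α x) = 0 := congr($hx)
    rw [← Matrix.fromBlocks_zero, Matrix.fromBlocks_inj] at h0
    refine hinj x ?_ ?_
    · rw [← hM0, hαβ, h0.1, h0.2.1, add_zero]
    · rw [← hM0, hαβ', h0.1, h0.2.1, sub_zero]
  have hqsurj : Function.Surjective q := by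
    rintro ⟨X, h1, h3⟩
    -- For blocks `a`, `b`, one needs an element on which `M` is `a + b` and `M ∘ parity` is `a -
    -- b`. As in the Chinese remainder theorem, `y2` supplies the first value and is killed by the
    -- second map, and `z1` the reverse.
    obtain ⟨y, hy⟩ := hMsurj (X.toBlocks₁₁ + X.toBlocks₁₂)
    obtain ⟨z, hz⟩ := hMsurj (X.toBlocks₁₁ - X.toBlocks₁₂)
    obtain ⟨y1, y2, hy1, hy2, rfl⟩ := hdec y
    obtain ⟨z1, z2, hz1, hz2, hz3⟩ := hdec (V.parity z)
    rw [← hM0] at hy1 hy2 hz1 hz2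
    have hz4 := congrArg V.parity hz3
    rw [parity_parity, map_add] at hz4
    rw [map_add, hy1, zero_add] at hy
    rw [hz4, map_add, hz2, add_zero] at hz
    refine ⟨y2 + z1, Subtype.ext ?_⟩
    have hA : α (y2 + z1) = X.toBlocks₁₁ := by
      rw [hα, map_add, map_add, map_add, hy, hz1, hz, hy2]
      module
    have hB : β (y2 + z1) = X.toBlocks₁₂ := by
      rw [hβ, map_add, map_add, map_add, hy, hz1, hz, hy2]
      module
    change Matrix.fromBlocks _ _ _ _ = X
    rw [hA, hB]
    conv_rhs => rw [← Matrix.fromBlocks_toBlocks X, ← h1, ← h3]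
  refine ⟨n, Module.finrank_pos, ?_⟩
  let e : V ≃ₗ[K] (queerSuperalgebra K n) := LinearEquiv.ofBijective q ⟨hqinj, hqsurj⟩
  refine isomorphic_of_mem_grade e (fun x y => ?_) fun i x hx => ?_
  · refine Subtype.ext ?_
    change Matrix.fromBlocks _ _ _ _ = Matrix.fromBlocks _ _ _ _ * Matrix.fromBlocks _ _ _ _
    rw [Matrix.fromBlocks_multiply, hαmul, hβmul, add_comm (β x * α y) (α x * β y),
      add_comm (β x * β y) (α x * α y)]
  · change Matrix.fromBlocks (α x) (β x) (β x) (α x) ∈ matrixGrade K n n i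
    have h01 (i : ZMod 2) : i = 0 ∨ i = 1 := by revert i; decide
    rcases h01 i with rfl | rfl
    · have hβ0 : β x = 0 := by
        rw [hβ, parity_of_mem hx, sgn_zero, one_smul, sub_self, smul_zero]
      rw [hβ0]
      rintro (a | a) (b | b) h
      · exact absurd rfl h
      · rfl
      · rfl
      · exact absurd (show (1 + 1 : ZMod 2) = 0 by decide) h
    · have hα0 : α x = 0 := by
        rw [hα, parity_of_mem hx, sgn_one, neg_smul, one_smul, map_neg, add_neg_cancel, smul_zero]
      rw [hα0]
      rintro (a | a) (b | b) h
      · rfl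
      · exact absurd rfl h
      · exact absurd rfl h
      · rfl

/-- Wall's theorem over an algebraically closed field, for superalgebras not assumed unital. -/
theorem IsGradedSimple.isMatrix_or_isQueer [CharZero K] [IsAlgClosed K]
    {V : AssocSuperalgebra.{u, v} K} (hV : V.IsGradedSimple) (h0 : ∃ x y : V, x * y ≠ 0) :
    V.IsMatrixSuperalgebra ∨ V.IsQueerSuperalgebra := by
  obtain ⟨P, L, hP, hL, hsurj⟩ := hV.exists_surjective h0
  by_cases hker : ∃ x, L x = 0 ∧ x ≠ 0
  · exact Or.inr (isQueerSuperalgebra_of_surjective hV L hL hsurj hker)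
  · push Not at hker
    have hinj : Function.Injective L := (injective_iff_map_eq_zero L).2 hker
    exact Or.inl (isMatrixSuperalgebra_of_linearEquiv (LinearEquiv.ofBijective L ⟨hinj, hsurj⟩) hL)

end AssocSuperalgebra

/-! ### The form, adjoints and isotropic splittings -/

namespace EvenSymmetricSuperalgebra

open AssocSuperalgebra

variable {K : Type u} [Field K] (A : EvenSymmetricSuperalgebra.{u, v} K)

/-- The form pairs only equal degrees, so the sign `(-1)^(|x||y|)` may be read as `(-1)^|x|`. This
makes supersymmetry a statement about all elements. -/
theorem form_comm (x y : A) : A.form x y = A.form y (A.parity x) := by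
  obtain ⟨a, ha, b, hb, rfl⟩ := A.exists_eq_add x
  obtain ⟨c, hc, d, hd, rfl⟩ := A.exists_eq_add y
  have h1 := A.form_supersymm 0 0 a c ha hc
  have h2 := A.form_supersymm 1 1 b d hb hd
  have h01 : (0 : ZMod 2) ≠ 1 := by decide
  rw [zero_mul, sgn_zero, one_mul] at h1
  rw [one_mul, sgn_one] at h2
  rw [parity_add_of_mem ha hb]
  simp only [map_add, map_sub, LinearMap.add_apply, A.form_even 0 1 a d ha hd h01,
    A.form_even 1 0 b c hb hc h01.symm, A.form_even 0 1 c b hc hb h01,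
    A.form_even 1 0 d a hd ha h01.symm, h1, h2]
  ring

theorem form_parity (x y : A) : A.form (A.parity x) (A.parity y) = A.form x y := by
  rw [A.form_comm x, A.form_comm y]

theorem form_parity_left (x y : A) : A.form (A.parity x) y = A.form x (A.parity y) := by
  rw [← A.form_parity x, parity_parity]

theorem form_mul_left (a x y : A) : A.form (a * x) y = A.form x (y * A.parity a) := by
  rw [A.form_assoc, A.form_comm, A.form_assoc]

theorem form_ext {x y : A} (h : ∀ z, A.form x z = A.form y z) : x = y :=
  sub_eq_zero.1 (A.form_nondeg _ fun z => by rw [map_sub, LinearMap.sub_apply, h, sub_self])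

/-- The identification of `A` with its dual given by the form. -/
noncomputable def formEquiv : A ≃ₗ[K] Module.Dual K A :=
  LinearEquiv.ofBijective A.form <| by
    have h : Function.Injective A.form := fun x y h => A.form_ext fun z => by rw [h]
    exact ⟨h, (LinearMap.injective_iff_surjective_of_finrank_eq_finrank
      Subspace.dual_finrank_eq.symm).1 h⟩

theorem form_formEquiv_symm (φ : Module.Dual K A) (x : A) : A.form (A.formEquiv.symm φ) x = φ x :=
  congr($(A.formEquiv.apply_symm_apply φ) x)

/-- The adjoint of an endomorphism. -/
theorem exists_adjoint (e : A →ₗ[K] A) (he : ∀ x, e (A.parity x) = A.parity (e x)) :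
    ∃ f : A →ₗ[K] A, (∀ x y, A.form (e x) y = A.form x (f y)) ∧
      ∀ x y, A.form (f x) y = A.form x (e y) := by
  let f : A →ₗ[K] A := A.formEquiv.symm.toLinearMap ∘ₗ e.dualMap ∘ₗ A.formEquiv.toLinearMap
  have hf (x y : A) : A.form (f x) y = A.form x (e y) := A.form_formEquiv_symm _ y
  refine ⟨f, fun x y => ?_, hf⟩
  -- The second adjunction is the definition of `f`. Supersymmetry gives the first, the two parities
  -- cancelling because `e` commutes with parity.
  rw [A.form_comm, ← he, ← hf, ← A.form_comm]

/-- A projection onto a graded subspace that respects degrees. -/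
theorem exists_even_projection [CharZero K] (I : Submodule K A) (hI : ∀ x ∈ I, A.parity x ∈ I) :
    ∃ e : A →ₗ[K] A, (∀ x, e x ∈ I) ∧ (∀ x ∈ I, e x = x) ∧
      ∀ x, e (A.parity x) = A.parity (e x) := by
  have h2 : (2 : K) ≠ 0 := two_ne_zero
  obtain ⟨J, hJ⟩ := I.exists_isCompl
  let π := I.projection J hJ
  have hπ (x : A) : π x ∈ I := I.projection_apply_mem hJ x
  -- The average of a projection onto `I` and its conjugate by parity is a projection onto `I` that
  -- commutes with parity.
  refine ⟨(2⁻¹ : K) • (π + A.parity ∘ₗ π ∘ₗ A.parity), fun x => ?_, fun x hx => ?_, fun x => ?_⟩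
  · exact I.smul_mem _ (I.add_mem (hπ x) (hI _ (hπ _)))
  · change (2⁻¹ : K) • (π x + A.parity (π (A.parity x))) = x
    rw [I.projection_apply_of_mem_left hJ hx, I.projection_apply_of_mem_left hJ (hI x hx),
      parity_parity, inv_smul_eq_iff₀ h2, two_smul]
  · change (2⁻¹ : K) • (π (A.parity x) + A.parity (π (A.parity (A.parity x)))) =
      A.parity ((2⁻¹ : K) • (π x + A.parity (π (A.parity x))))
    rw [map_smul, map_add, parity_parity, parity_parity, add_comm]

/-- Even adjoint idempotents `e`, `f` with `e f = f e = 0`, the range of `e` being `I`. -/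
structure IsotropicSplitting (I : Submodule K A) where
  e : A →ₗ[K] A
  f : A →ₗ[K] A
  e_mem : ∀ x, e x ∈ I
  e_of_mem : ∀ x ∈ I, e x = x
  e_parity : ∀ x, e (A.parity x) = A.parity (e x)
  form_e : ∀ x y, A.form (e x) y = A.form x (f y)
  form_f : ∀ x y, A.form (f x) y = A.form x (e y)
  f_e : ∀ x, f (e x) = 0
  e_f : ∀ x, e (f x) = 0

/-- Take an even projection `e` onto `I` and its adjoint `f`. Isotropy gives `f e = 0`, but `e f`
may be nonzero. Subtracting half of the self-adjoint map `e f` from each keeps them adjoint and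
makes the product vanish: `e f - e f / 2 - e f / 2 = 0`. -/
theorem exists_isotropicSplitting [CharZero K] (I : Submodule K A) (hI : ∀ x ∈ I, A.parity x ∈ I)
    (hiso : ∀ x ∈ I, ∀ y ∈ I, A.form x y = 0) : Nonempty (A.IsotropicSplitting I) := by
  obtain ⟨e, he, heI, heσ⟩ := A.exists_even_projection I hI
  obtain ⟨f, hf1, hf2⟩ := A.exists_adjoint e heσ
  have h2 : (2 : K) ≠ 0 := two_ne_zero
  have hee (x : A) : e (e x) = e x := heI _ (he x)
  have hff (x : A) : f (f x) = f x := A.form_ext fun z => by rw [hf2, hf2, hee, hf2]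
  have hfe (x : A) : f (e x) = 0 := A.form_nondeg _ fun z => by
    rw [hf2]
    exact hiso _ (he x) _ (he z)
  have hfσ (x : A) : f (A.parity x) = A.parity (f x) := A.form_ext fun z => by
    rw [hf2, A.form_parity_left, A.form_parity_left, hf2, heσ]
  refine ⟨⟨e - (2⁻¹ : K) • (e ∘ₗ f), f - (2⁻¹ : K) • (e ∘ₗ f), fun x => ?_, fun x hx => ?_,
    fun x => ?_, fun x y => ?_, fun x y => ?_, fun x => ?_, fun x => ?_⟩⟩ <;>
    simp only [LinearMap.sub_apply, LinearMap.smul_apply, LinearMap.comp_apply, map_sub, map_smul,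
      hee, hff, hfe, hfσ, heσ, hf1, hf2, map_zero, smul_zero, sub_zero]
  · exact I.sub_mem (he _) (I.smul_mem _ (he _))
  · have hfx : f x = 0 := by rw [← heI x hx, hfe]
    rw [heI x hx, hfx, map_zero, smul_zero, sub_zero]
  · module

variable {A}

/-- Compression to a self-adjoint idempotent. -/
theorem exists_compression [CharZero K] (π : A →ₗ[K] A)
    (hπ : ∀ x, π (π x) = π x) (hσ : ∀ x, π (A.parity x) = A.parity (π x))
    (hl : ∀ x y z, π (π (π x * π y) * π z) = π (π x * π y * π z))
    (hr : ∀ x y z, π (π x * π (π y * π z)) = π (π x * (π y * π z)))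
    (hadj : ∀ x y, A.form (π x) y = A.form x (π y)) :
    ∃ (W : EvenSymmetricSuperalgebra.{u, v} K)
      (c : Compression A.toAssocSuperalgebra W.toAssocSuperalgebra π),
      ∀ x y, W.form x y = A.form (c.incl x) (c.incl y) := by
  obtain ⟨W, ⟨c⟩⟩ := A.toAssocSuperalgebra.exists_compression π hπ hσ hl hr
  refine ⟨{ W with
    form := A.form.compl₁₂ c.incl c.incl
    form_even := fun i j x y hx hy hij =>
      A.form_even i j _ _ ((c.mem_grade i x).1 hx) ((c.mem_grade j y).1 hy) hij
    form_supersymm := fun i j x y hx hy =>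
      A.form_supersymm i j _ _ ((c.mem_grade i x).1 hx) ((c.mem_grade j y).1 hy)
    form_assoc := fun x y z => ?_
    form_nondeg := fun x hx => ?_ }, c, fun x y => rfl⟩
  · change A.form (c.incl (x * y)) (c.incl z) = A.form (c.incl x) (c.incl (y * z))
    rw [c.mul_eq, c.mul_eq, c.incl_proj, c.incl_proj, hadj (c.incl x * c.incl y),
      ← hadj (c.incl x), c.apply_incl, c.apply_incl,
      A.form_assoc]
  · refine c.incl_injective ?_
    rw [map_zero]
    refine A.form_nondeg _ fun z => ?_
    rw [← c.apply_incl, hadj, ← c.incl_proj]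
    exact hx (c.proj z)

section DoubleExtension

variable {I : Submodule K A} (S : A.IsotropicSplitting I)

namespace IsotropicSplitting

theorem e_e (x : A) : S.e (S.e x) = S.e x := S.e_of_mem _ (S.e_mem x)

theorem f_f (x : A) : S.f (S.f x) = S.f x :=
  A.form_ext fun z => by rw [S.form_f, S.form_f, S.e_e, S.form_f]

theorem f_parity (x : A) : S.f (A.parity x) = A.parity (S.f x) :=
  A.form_ext fun z => by
    rw [S.form_f, A.form_parity_left, A.form_parity_left, S.form_f, S.e_parity]

theorem f_of_mem {x : A} (hx : x ∈ I) : S.f x = 0 := by rw [← S.e_of_mem x hx, S.f_e]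

/-- The kernel of `f` is `I^⊥`, so the range of `f` is a model of `A/I^⊥`. -/
theorem f_eq_zero_iff {x : A} : S.f x = 0 ↔ ∀ y ∈ I, A.form x y = 0 := by
  constructor
  · intro h y hy
    rw [← S.e_of_mem y hy, ← S.form_f, h, map_zero, LinearMap.zero_apply]
  · intro h
    exact A.form_nondeg _ fun z => by rw [S.form_f, h _ (S.e_mem z)]

/-- The projection onto the orthogonal of the ranges of `e` and `f`. -/
noncomputable def w : A →ₗ[K] A := LinearMap.id - S.e - S.f

theorem w_apply (x : A) : S.w x = x - S.e x - S.f x := rfl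

theorem e_w (x : A) : S.e (S.w x) = 0 := by
  rw [w_apply, map_sub, map_sub, S.e_e, S.e_f, sub_self, sub_zero]

theorem f_w (x : A) : S.f (S.w x) = 0 := by
  rw [w_apply, map_sub, map_sub, S.f_f, S.f_e, sub_zero, sub_self]

theorem w_w (x : A) : S.w (S.w x) = S.w x := by
  rw [w_apply (S := S) (x := S.w x), S.e_w, S.f_w, sub_zero, sub_zero]

theorem w_f (x : A) : S.w (S.f x) = 0 := by
  rw [w_apply, S.e_f, S.f_f, sub_zero, sub_self]

theorem w_of_mem {x : A} (hx : x ∈ I) : S.w x = 0 := by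
  rw [w_apply, S.e_of_mem x hx, S.f_of_mem hx, sub_self, sub_zero]

theorem w_parity (x : A) : S.w (A.parity x) = A.parity (S.w x) := by
  rw [w_apply, w_apply, S.e_parity, S.f_parity, map_sub, map_sub]

theorem form_w (x y : A) : A.form (S.w x) y = A.form x (S.w y) := by
  rw [w_apply, w_apply, map_sub, map_sub, map_sub, map_sub, LinearMap.sub_apply,
    LinearMap.sub_apply, S.form_e, S.form_f]
  ring

variable (hI : A.IsGradedIdeal I)
include hI

theorem f_mul_left (a : A) {x : A} (hx : S.f x = 0) : S.f (a * x) = 0 := by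
  rw [f_eq_zero_iff] at hx ⊢
  intro y hy
  rw [form_mul_left]
  exact hx _ (hI.mul_mem_right _ y hy)

theorem f_mul_right (a : A) {x : A} (hx : S.f x = 0) : S.f (x * a) = 0 := by
  rw [f_eq_zero_iff] at hx ⊢
  intro y hy
  rw [A.form_assoc]
  exact hx _ (hI.mul_mem_left _ y hy)

/-- `x - f x` lies in the ideal `I^⊥`, the kernel of `f`. This and `f_mul_f` make the compressed
product that of the quotient `A/I^⊥`. -/
theorem f_f_mul (x y : A) : S.f (S.f x * y) = S.f (x * y) := by
  have h : S.f (x - S.f x) = 0 := by rw [map_sub, S.f_f, sub_self]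
  have := S.f_mul_right hI y h
  rw [sub_mul, map_sub, sub_eq_zero] at this
  exact this.symm

theorem f_mul_f (x y : A) : S.f (x * S.f y) = S.f (x * y) := by
  have h : S.f (y - S.f y) = 0 := by rw [map_sub, S.f_f, sub_self]
  have := S.f_mul_left hI x h
  rw [mul_sub, map_sub, sub_eq_zero] at this
  exact this.symm

/-- On `I^⊥` the maps `w` and the identity differ by `e`, whose values lie in the ideal `I` killed
by `w`. So `w` acts as the quotient map from `I^⊥` to `I^⊥/I`. -/
theorem w_w_mul {x : A} (hx : S.f x = 0) (y : A) : S.w (S.w x * y) = S.w (x * y) := by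
  rw [S.w_apply x, hx, sub_zero, sub_mul, map_sub,
    S.w_of_mem (hI.mul_mem_right y _ (S.e_mem x)), sub_zero]

theorem w_mul_w (x : A) {y : A} (hy : S.f y = 0) : S.w (x * S.w y) = S.w (x * y) := by
  rw [S.w_apply y, hy, sub_zero, mul_sub, map_sub,
    S.w_of_mem (hI.mul_mem_left x _ (S.e_mem y)), sub_zero]

/-- The ideals `I` and `I^⊥` annihilate each other, by invariance of the form. Hence the `V*`-part
of the extension multiplies to zero with `W` and with itself. -/
theorem mul_eq_zero_left {x y : A} (hx : x ∈ I) (hy : S.f y = 0) : x * y = 0 :=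
  A.form_nondeg _ fun z => by
    have h : A.parity x ∈ I := hI.parity_mem x hx
    rw [A.form_assoc, A.form_comm]
    exact S.f_eq_zero_iff.1 (S.f_mul_right hI z hy) _ h

theorem mul_eq_zero_right {x y : A} (hx : S.f x = 0) (hy : y ∈ I) : x * y = 0 :=
  A.form_nondeg _ fun z => by
    rw [A.form_assoc]
    exact S.f_eq_zero_iff.1 hx _ (hI.mul_mem_right z y hy)

theorem exists_compression_f [CharZero K] :
    ∃ V : AssocSuperalgebra.{u, v} K, Nonempty (Compression A.toAssocSuperalgebra V S.f) :=
  A.toAssocSuperalgebra.exists_compression S.f S.f_f S.f_parity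
    (fun _ _ _ => S.f_f_mul hI _ _) fun _ _ _ => S.f_mul_f hI _ _

theorem exists_compression_w [CharZero K] :
    ∃ (W : EvenSymmetricSuperalgebra.{u, v} K)
      (c : Compression A.toAssocSuperalgebra W.toAssocSuperalgebra S.w),
      ∀ x y, W.form x y = A.form (c.incl x) (c.incl y) :=
  exists_compression S.w S.w_w S.w_parity
    (fun _ y _ => S.w_w_mul hI (S.f_mul_left hI _ (S.f_w y)) _)
    (fun _ _ z => S.w_mul_w hI _ (S.f_mul_left hI _ (S.f_w z))) S.form_w

end IsotropicSplitting

end DoubleExtension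

end EvenSymmetricSuperalgebra

/-! ### The context of extension read off from the product of `A` -/

namespace EvenSymmetricSuperalgebra

open AssocSuperalgebra

variable {K : Type u} [Field K] {A : EvenSymmetricSuperalgebra.{u, v} K}

namespace IsotropicSplitting

variable {I : Submodule K A} (S : A.IsotropicSplitting I) {V : AssocSuperalgebra.{u, v} K}
  (cV : Compression A.toAssocSuperalgebra V S.f) {W : EvenSymmetricSuperalgebra.{u, v} K}
  (cW : Compression A.toAssocSuperalgebra W.toAssocSuperalgebra S.w)

theorem f_incl_w (x : W) : S.f (cW.incl x) = 0 := by rw [← cW.apply_incl, S.f_w]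

theorem e_incl_w (x : W) : S.e (cW.incl x) = 0 := by rw [← cW.apply_incl, S.e_w]

theorem e_incl_f (a : V) : S.e (cV.incl a) = 0 := by rw [← cV.apply_incl, S.e_f]

theorem proj_w_incl_f (a : V) : cW.proj (cV.incl a) = 0 := by
  rw [cW.proj_eq_zero, ← cV.apply_incl, S.w_f]

theorem proj_f_incl_w (x : W) : cV.proj (cW.incl x) = 0 := by
  rw [cV.proj_eq_zero, S.f_incl_w cW]

theorem proj_f_of_mem {y : A} (hy : y ∈ I) : cV.proj y = 0 := by
  rw [cV.proj_eq_zero, S.f_of_mem hy]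

theorem proj_w_of_mem {y : A} (hy : y ∈ I) : cW.proj y = 0 := by
  rw [cW.proj_eq_zero, S.w_of_mem hy]

theorem eq_incl_add (y : A) : y = cV.incl (cV.proj y) + cW.incl (cW.proj y) + S.e y := by
  rw [cV.incl_proj, cW.incl_proj, S.w_apply]
  abel

theorem form_incl_f_incl_f (a b : V) : A.form (cV.incl a) (cV.incl b) = 0 := by
  rw [← cV.apply_incl, S.form_f, S.e_incl_f, map_zero]

theorem form_incl_f_incl_w (a : V) (x : W) : A.form (cV.incl a) (cW.incl x) = 0 := by
  rw [← cV.apply_incl, S.form_f, S.e_incl_w cW, map_zero]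

theorem form_incl_w_incl_f (x : W) (a : V) : A.form (cW.incl x) (cV.incl a) = 0 := by
  rw [← cV.apply_incl, ← S.form_e, S.e_incl_w cW, map_zero, LinearMap.zero_apply]

theorem form_incl_w_mem (x : W) {y : A} (hy : y ∈ I) : A.form (cW.incl x) y = 0 :=
  S.f_eq_zero_iff.1 (S.f_incl_w cW x) y hy

theorem form_mem_incl_w {y : A} (hy : y ∈ I) (x : W) : A.form y (cW.incl x) = 0 := by
  rw [← S.e_of_mem y hy, S.form_e, S.f_incl_w cW, map_zero]

include S in
theorem form_mem_mem {x y : A} (hx : x ∈ I) (hy : y ∈ I) : A.form x y = 0 :=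
  S.f_eq_zero_iff.1 (S.f_of_mem hx) y hy

include cV in
theorem form_incl_w (x : W) (y : A) :
    A.form (cW.incl x) y = A.form (cW.incl x) (cW.incl (cW.proj y)) := by
  conv_lhs => rw [S.eq_incl_add cV cW y]
  rw [map_add, map_add, S.form_incl_w_incl_f, S.form_incl_w_mem cW x (S.e_mem y), zero_add,
    add_zero]

theorem form_incl_f (a : V) (y : A) : A.form (cV.incl a) (S.e y) = A.form (cV.incl a) y := by
  rw [← S.form_f, cV.apply_incl]

theorem form_e_incl_f (y : A) (a : V) : A.form (S.e y) (cV.incl a) = A.form y (cV.incl a) := by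
  rw [S.form_e, cV.apply_incl]

/-- `W` is orthogonal to the copy of `V` and to `I`, which are isotropic. In the mixed terms the
full `x` and `y` may replace their `I`-components, since only these pair with the copy of `V`. -/
theorem form_eq (x y : A) : A.form x y =
    A.form (cW.incl (cW.proj x)) (cW.incl (cW.proj y)) + A.form x (cV.incl (cV.proj y))
      + A.form (cV.incl (cV.proj x)) y := by
  conv_lhs => rw [S.eq_incl_add cV cW x, S.eq_incl_add cV cW y]
  simp only [map_add, LinearMap.add_apply, S.form_incl_f_incl_f, S.form_incl_f_incl_w,
    S.form_incl_w_incl_f, S.form_incl_w_mem cW _ (S.e_mem _), S.form_mem_incl_w cW (S.e_mem _),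
    S.form_mem_mem (S.e_mem _) (S.e_mem _), S.form_incl_f, S.form_e_incl_f]
  ring

/-- The copy of `V` in `A` is not closed under multiplication. The `W`-part of the defect is `lam`,
and the `I`-part, seen through the form, is `gam`. -/
theorem incl_f_mul (a b : V) : cV.incl (a * b) = cV.incl a * cV.incl b
    - cW.incl (cW.proj (cV.incl a * cV.incl b)) - S.e (cV.incl a * cV.incl b) := by
  conv_rhs => enter [1, 1]; rw [S.eq_incl_add cV cW (cV.incl a * cV.incl b)]
  rw [cV.mul_eq]
  abel

section

variable (hI : A.IsGradedIdeal I)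
include hI

theorem proj_f_mul (x y : A) : cV.proj (x * y) = cV.proj x * cV.proj y := by
  rw [cV.mul_eq, cV.incl_proj, cV.incl_proj, ← cV.proj_apply, ← cV.proj_apply (S.f x * S.f y),
    S.f_f_mul hI, S.f_mul_f hI]

theorem proj_w_mul_incl {x : A} (hx : S.f x = 0) (y : A) :
    cW.proj (cW.incl (cW.proj x) * y) = cW.proj (x * y) := by
  rw [cW.incl_proj, ← cW.proj_apply, S.w_w_mul hI hx, cW.proj_apply]

theorem proj_mul_w_incl (x : A) {y : A} (hy : S.f y = 0) :
    cW.proj (x * cW.incl (cW.proj y)) = cW.proj (x * y) := by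
  rw [cW.incl_proj, ← cW.proj_apply, S.w_mul_w hI _ hy, cW.proj_apply]

theorem proj_w_mul_e (x y : A) : cW.proj (x * S.e y) = 0 :=
  S.proj_w_of_mem cW (hI.mul_mem_left _ _ (S.e_mem y))

theorem proj_w_e_mul (x y : A) : cW.proj (S.e x * y) = 0 :=
  S.proj_w_of_mem cW (hI.mul_mem_right _ _ (S.e_mem x))

/-- The context of generalized double extension attached to the splitting. -/
noncomputable def extensionContext [CharZero K]
    (hW : ∀ x y, W.form x y = A.form (cW.incl x) (cW.incl y)) : ExtensionContext W V where
  -- `mu` and `muAdj` are the `W`-components of left and right multiplication by the copy of `V`.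
  -- `lam` and `gam` are the `W`- and `V*`-components of products inside that copy.
  mu := ((LinearMap.mul K A).compl₁₂ cV.incl cW.incl).compr₂ cW.proj
  muAdj := ((LinearMap.mul K A).flip.compl₁₂ cV.incl cW.incl).compr₂ cW.proj
  lam := ((LinearMap.mul K A).compl₁₂ cV.incl cV.incl).compr₂ cW.proj
  gam := ((LinearMap.mul K A).compl₁₂ cV.incl cV.incl).compr₂ (A.form.compl₂ cV.incl)
  mu_even i j a x ha hx := by
    have := A.mul_mem_grade i j _ _ ((cV.mem_grade i a).1 ha) ((cW.mem_grade j x).1 hx)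
    exact cW.proj_mem_grade S.w_parity this
  lam_even i j a b ha hb := by
    have := A.mul_mem_grade i j _ _ ((cV.mem_grade i a).1 ha) ((cV.mem_grade j b).1 hb)
    exact cW.proj_mem_grade S.w_parity this
  gam_even i j a b ha hb := by
    have := A.mul_mem_grade i j _ _ ((cV.mem_grade i a).1 ha) ((cV.mem_grade j b).1 hb)
    rw [dualGrade, Submodule.mem_dualAnnihilator]
    intro c hc
    have h (i : ZMod 2) : i ≠ i + 1 := by revert i; decide
    exact A.form_even _ _ _ _ this ((cV.mem_grade _ c).1 hc) (h _)
  form_mu i j k a x y ha hx hy := by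
    have := A.mul_mem_grade j k _ _ ((cW.mem_grade j x).1 hx) ((cW.mem_grade k y).1 hy)
    have h := A.form_supersymm i (j + k) _ _ ((cV.mem_grade i a).1 ha) this
    rw [hW, hW]
    change A.form (cW.incl (cW.proj (cV.incl a * cW.incl x))) (cW.incl y) =
      _ * A.form (cW.incl x) (cW.incl (cW.proj (cW.incl y * cV.incl a)))
    rw [← S.form_incl_w cV cW, cW.incl_proj, S.form_w, cW.apply_incl, A.form_assoc, h,
      A.form_assoc]
  muAdj_mul a x y := by
    change cW.proj (cW.incl (x * y) * cV.incl a) = x * cW.proj (cW.incl y * cV.incl a)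
    rw [cW.mul_eq, cW.mul_eq, S.proj_w_mul_incl cW hI (S.f_mul_left hI _ (S.f_incl_w cW y)),
      S.proj_mul_w_incl cW hI _ (S.f_mul_right hI _ (S.f_incl_w cW y)), mul_assoc]
  muAdj_comm a b x := by
    change cW.proj (cW.incl (cW.proj (cV.incl a * cW.incl x)) * cV.incl b) =
      cW.proj (cV.incl a * cW.incl (cW.proj (cW.incl x * cV.incl b)))
    rw [S.proj_w_mul_incl cW hI (S.f_mul_left hI _ (S.f_incl_w cW x)),
      S.proj_mul_w_incl cW hI _ (S.f_mul_right hI _ (S.f_incl_w cW x)), mul_assoc]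
  muAdj_comp a b x := by
    change cW.proj (cW.incl x * cV.incl (a * b)) =
      cW.proj (cW.incl (cW.proj (cW.incl x * cV.incl a)) * cV.incl b)
        - x * cW.proj (cV.incl a * cV.incl b)
    rw [S.proj_w_mul_incl cW hI (S.f_mul_right hI _ (S.f_incl_w cW x)), S.incl_f_mul cV cW,
      mul_sub, mul_sub, map_sub, map_sub, S.proj_w_mul_e cW hI, sub_zero, mul_assoc,
      cW.mul_eq]
  muAdj_lam a b c := by
    change cW.proj (cW.incl (cW.proj (cV.incl a * cV.incl b)) * cV.incl c) =
      cW.proj (cV.incl a * cW.incl (cW.proj (cV.incl b * cV.incl c)))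
        + cW.proj (cV.incl a * cV.incl (b * c)) - cW.proj (cV.incl (a * b) * cV.incl c)
    rw [S.incl_f_mul cV cW a b, S.incl_f_mul cV cW b c]
    simp only [mul_sub, sub_mul, map_sub, S.proj_w_mul_e cW hI, S.proj_w_e_mul cW hI, mul_assoc]
    abel
  gam_cyclic i j k a b c ha hb hc := by
    have := A.mul_mem_grade j k _ _ ((cV.mem_grade j b).1 hb) ((cV.mem_grade k c).1 hc)
    have h := A.form_supersymm i (j + k) _ _ ((cV.mem_grade i a).1 ha) this
    change A.form (cV.incl a * cV.incl b) (cV.incl c) =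
      _ * A.form (cV.incl b * cV.incl c) (cV.incl a)
    rw [A.form_assoc, h]
  gam_cocycle i j k l a b c d ha hb hc hd := by
    have h3 (z : A) (hz : z ∈ A.grade (j + k + l)) := A.form_supersymm i (j + k + l) _ z
      ((cV.mem_grade i a).1 ha) hz
    have hb' := (cV.mem_grade j b).1 hb
    have hc' := (cV.mem_grade k c).1 hc
    have hd' := (cV.mem_grade l d).1 hd
    rw [hW, hW]
    change - A.form (cW.incl (cW.proj (cV.incl a * cV.incl b)))
          (cW.incl (cW.proj (cV.incl c * cV.incl d)))
        + _ * A.form (cW.incl (cW.proj (cV.incl b * cV.incl c)))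
          (cW.incl (cW.proj (cV.incl d * cV.incl a))) =
      A.form (cV.incl (a * b) * cV.incl c) (cV.incl d)
        + A.form (cV.incl a * cV.incl b) (cV.incl (c * d))
        - A.form (cV.incl a * cV.incl (b * c)) (cV.incl d)
        - _ * A.form (cV.incl b * cV.incl c) (cV.incl (d * a))
    -- The cocycle identity expresses cyclic invariance of `A.form` on the product of four elements
    -- (`e3`), with both sides expanded along `V ⊕ W ⊕ I` by `e1` and `e2`.
    have e1 := S.form_eq cV cW (cV.incl a * cV.incl b) (cV.incl c * cV.incl d)
    have e2 := S.form_eq cV cW (cV.incl b * cV.incl c) (cV.incl d * cV.incl a)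
    rw [← cV.mul_eq, ← cV.mul_eq] at e1 e2
    have e3 : A.form (cV.incl a * cV.incl b) (cV.incl c * cV.incl d) =
        sgn K (i * (j + k + l)) *
          A.form (cV.incl b * cV.incl c) (cV.incl d * cV.incl a) := by
      rw [A.form_assoc, ← mul_assoc (cV.incl b), h3 _ (A.mul_mem_grade _ _ _ _
        (A.mul_mem_grade _ _ _ _ hb' hc') hd'), A.form_assoc]
    have e4 : A.form (cV.incl a * cV.incl (b * c)) (cV.incl d) =
        sgn K (i * (j + k + l)) * A.form (cV.incl (b * c)) (cV.incl d * cV.incl a) := by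
      rw [A.form_assoc, h3 _ (A.mul_mem_grade _ _ _ _
        ((cV.mem_grade _ _).1 (V.mul_mem_grade _ _ _ _ hb hc)) hd'), A.form_assoc]
    rw [e4, A.form_assoc (cV.incl (a * b))]
    linear_combination e1 - e3 - sgn K (i * (j + k + l)) * e2

end

end IsotropicSplitting

end EvenSymmetricSuperalgebra

/-! ### The decomposition of `A` as a generalized double extension -/

namespace EvenSymmetricSuperalgebra

open AssocSuperalgebra

variable {K : Type u} [Field K] {A : EvenSymmetricSuperalgebra.{u, v} K}

namespace IsotropicSplitting

variable {I : Submodule K A} (S : A.IsotropicSplitting I) {V : AssocSuperalgebra.{u, v} K}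
  (cV : Compression A.toAssocSuperalgebra V S.f) {W : EvenSymmetricSuperalgebra.{u, v} K}
  (cW : Compression A.toAssocSuperalgebra W.toAssocSuperalgebra S.w)

/-- The embedding of the dual of `V` with image `I`. -/
noncomputable def dualIncl : Module.Dual K V →ₗ[K] A :=
  A.formEquiv.symm.toLinearMap ∘ₗ cV.proj.dualMap

theorem form_dualIncl (φ : Module.Dual K V) (y : A) :
    A.form (S.dualIncl cV φ) y = φ (cV.proj y) :=
  A.form_formEquiv_symm _ _

theorem dualIncl_mem (φ : Module.Dual K V) : S.dualIncl cV φ ∈ I := by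
  have : S.e (S.dualIncl cV φ) = S.dualIncl cV φ := A.form_ext fun z => by
    rw [S.form_e, S.form_dualIncl, S.form_dualIncl, cV.proj_apply]
  rw [← this]
  exact S.e_mem _

/-- The `I`-component of `y` is determined by the pairing of `y` with the copy of `V`. Identities in
the `V*`-component are therefore checked by pairing with `cV.incl c`. -/
theorem dualIncl_form (y : A) : S.dualIncl cV (A.form.compl₂ cV.incl y) = S.e y :=
  A.form_ext fun z => by
    rw [S.form_dualIncl, LinearMap.compl₂_apply, cV.incl_proj, S.form_e]

theorem dualIncl_mem_grade [CharZero K] {i : ZMod 2} {φ : Module.Dual K V}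
    (hφ : φ ∈ V.dualGrade i) : S.dualIncl cV φ ∈ A.grade i := by
  have key (c : V) : φ (V.parity c) = sgn K i * φ c := by
    have h (i : ZMod 2) : i = 0 ∨ i = 1 := by revert i; decide
    rw [dualGrade, Submodule.mem_dualAnnihilator] at hφ
    obtain ⟨a, ha, b, hb, rfl⟩ := V.exists_eq_add c
    rw [parity_add_of_mem ha hb]
    rcases h i with rfl | rfl
    · have := hφ b hb
      rw [map_sub, map_add, this, sgn_zero]
      ring
    · have := hφ a ha
      rw [map_sub, map_add, this, sgn_one]
      ring
  rw [mem_grade_iff]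
  refine A.form_ext fun z => ?_
  have hp : cV.proj (A.parity z) = V.parity (cV.proj z) := by
    refine cV.incl_injective ?_
    rw [cV.incl_parity, cV.incl_proj, cV.incl_proj, S.f_parity]
  rw [A.form_parity_left, S.form_dualIncl, map_smul, LinearMap.smul_apply, S.form_dualIncl, hp,
    key, smul_eq_mul]

/-- The decomposition `A = V ⊕ W ⊕ V*`. -/
noncomputable def decomposition : (V × W × Module.Dual K V) ≃ₗ[K] A :=
  LinearEquiv.ofLinearMap
    (cV.incl.coprod (cW.incl.coprod (S.dualIncl cV)))
    (cV.proj.prod (cW.proj.prod (A.form.compl₂ cV.incl)))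
    (by
      ext y
      change cV.incl (cV.proj y) + (cW.incl (cW.proj y)
        + S.dualIncl cV (A.form.compl₂ cV.incl y)) = y
      rw [S.dualIncl_form, ← add_assoc]
      exact (S.eq_incl_add cV cW y).symm)
    (by
      refine LinearMap.ext fun ⟨a, x, φ⟩ => ?_
      have hφ := S.dualIncl_mem cV φ
      refine Prod.ext ?_ (Prod.ext ?_ (LinearMap.ext fun c => ?_))
      · change cV.proj (cV.incl a + (cW.incl x + S.dualIncl cV φ)) = a
        rw [map_add, map_add, cV.proj_incl, S.proj_f_incl_w cV cW, S.proj_f_of_mem cV hφ, add_zero,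
          add_zero]
      · change cW.proj (cV.incl a + (cW.incl x + S.dualIncl cV φ)) = x
        rw [map_add, map_add, cW.proj_incl, S.proj_w_incl_f cV cW, S.proj_w_of_mem cW hφ, add_zero,
          zero_add]
      · change A.form (cV.incl a + (cW.incl x + S.dualIncl cV φ)) (cV.incl c) = φ c
        rw [map_add, map_add, LinearMap.add_apply, LinearMap.add_apply, S.form_incl_f_incl_f,
          S.form_incl_w_incl_f, S.form_dualIncl, cV.proj_incl, zero_add, zero_add])

theorem decomposition_apply (a : V) (x : W) (φ : Module.Dual K V) :
    S.decomposition cV cW (a, x, φ) = cV.incl a + (cW.incl x + S.dualIncl cV φ) := rfl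

theorem decomposition_symm_apply (y : A) : (S.decomposition cV cW).symm y =
    (cV.proj y, cW.proj y, A.form.compl₂ cV.incl y) := rfl

theorem decomposition_mem_grade [CharZero K] (i : ZMod 2) (a : V) (x : W) (φ : Module.Dual K V) :
    S.decomposition cV cW (a, x, φ) ∈ A.grade i ↔
      a ∈ V.grade i ∧ x ∈ W.grade i ∧ φ ∈ V.dualGrade i := by
  constructor
  · intro h
    have h1 := (S.decomposition cV cW).symm_apply_apply (a, x, φ)
    generalize S.decomposition cV cW (a, x, φ) = y at h h1
    rw [decomposition_symm_apply, Prod.mk.injEq, Prod.mk.injEq] at h1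
    obtain ⟨ha, hx, hφ⟩ := h1
    rw [← ha, ← hx, ← hφ]
    refine ⟨cV.proj_mem_grade S.f_parity h, cW.proj_mem_grade S.w_parity h, ?_⟩
    rw [dualGrade, Submodule.mem_dualAnnihilator]
    intro c hc
    have h2 (i : ZMod 2) : i ≠ i + 1 := by revert i; decide
    exact A.form_even _ _ _ _ h ((cV.mem_grade _ c).1 hc) (h2 _)
  · rintro ⟨ha, hx, hφ⟩
    exact add_mem ((cV.mem_grade i a).1 ha)
      (add_mem ((cW.mem_grade i x).1 hx) (S.dualIncl_mem_grade cV hφ))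

theorem decomposition_mul [CharZero K] (hI : A.IsGradedIdeal I)
    (hW : ∀ x y, W.form x y = A.form (cW.incl x) (cW.incl y)) (i : ZMod 2) (a b : V) (x y : W)
    (f g : Module.Dual K V) (ha : a ∈ V.grade i) :
    S.decomposition cV cW (a, x, f) * S.decomposition cV cW (b, y, g) =
      S.decomposition cV cW (a * b,
        (S.extensionContext cV cW hI hW).lam a b + x * y
          + (S.extensionContext cV cW hI hW).mu a y + (S.extensionContext cV cW hI hW).muAdj b x,
        (S.extensionContext cV cW hI hW).gam a b
          + W.form x ∘ₗ (S.extensionContext cV cW hI hW).muAdj.flip y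
          + sgn K i • (W.form y ∘ₗ (S.extensionContext cV cW hI hW).lam.flip a)
          + sgn K i • (g ∘ₗ LinearMap.mulRight K a)
          + W.form x ∘ₗ (S.extensionContext cV cW hI hW).lam b
          + f ∘ₗ LinearMap.mulLeft K b) := by
  have hf := S.dualIncl_mem cV f
  have hg := S.dualIncl_mem cV g
  rw [← LinearEquiv.symm_apply_eq, decomposition_symm_apply]
  refine Prod.ext ?_ (Prod.ext ?_ (LinearMap.ext fun c => ?_))
  · change cV.proj (S.decomposition cV cW (a, x, f) * S.decomposition cV cW (b, y, g)) = a * b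
    rw [S.proj_f_mul cV hI]
    exact congrArg₂ (· * ·) congr(($((S.decomposition cV cW).symm_apply_apply (a, x, f))).1)
      congr(($((S.decomposition cV cW).symm_apply_apply (b, y, g))).1)
  · change cW.proj (S.decomposition cV cW (a, x, f) * S.decomposition cV cW (b, y, g)) =
      cW.proj (cV.incl a * cV.incl b) + x * y + cW.proj (cV.incl a * cW.incl y)
        + cW.proj (cW.incl x * cV.incl b)
    have h1 (z : A) : cW.proj (z * S.dualIncl cV g) = 0 :=
      S.proj_w_of_mem cW (hI.mul_mem_left _ _ hg)
    have h2 (z : A) : cW.proj (S.dualIncl cV f * z) = 0 :=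
      S.proj_w_of_mem cW (hI.mul_mem_right _ _ hf)
    simp only [decomposition_apply, add_mul, mul_add, map_add, h1, h2, cW.mul_eq, add_zero]
    abel
  · change A.form (S.decomposition cV cW (a, x, f) * S.decomposition cV cW (b, y, g)) (cV.incl c) =
      A.form (cV.incl a * cV.incl b) (cV.incl c)
        + W.form x (cW.proj (cW.incl y * cV.incl c))
        + sgn K i * W.form y (cW.proj (cV.incl c * cV.incl a))
        + sgn K i * g (c * a)
        + W.form x (cW.proj (cV.incl b * cV.incl c))
        + f (b * c)
    have h1 : cW.incl x * S.dualIncl cV g = 0 := S.mul_eq_zero_right hI (S.f_incl_w cW x) hg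
    have h2 : S.dualIncl cV f * cW.incl y = 0 := S.mul_eq_zero_left hI hf (S.f_incl_w cW y)
    have h3 : S.dualIncl cV f * S.dualIncl cV g = 0 := S.mul_eq_zero_left hI hf (S.f_of_mem hg)
    -- Moving `a` cyclically past the form costs the sign `(-1)^i`; this is the origin of the two
    -- signs in the product of the extension.
    have h4 (z : A) : A.form (cV.incl a * z) (cV.incl c) =
        sgn K i * A.form z (cV.incl c * cV.incl a) := by
      rw [A.form_mul_left, parity_of_mem ((cV.mem_grade i a).1 ha), mul_smul_comm, map_smul,
        smul_eq_mul]
    have h5 (x : W) (z : A) : W.form x (cW.proj z) = A.form (cW.incl x) z := by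
      rw [hW, ← S.form_incl_w cV cW]
    simp only [decomposition_apply, add_mul, mul_add, map_add, LinearMap.add_apply, h1, h2, h3, h5,
      h4 (cW.incl y), h4 (S.dualIncl cV g), S.form_dualIncl, S.proj_f_mul cV hI, cV.proj_incl,
      add_zero, A.form_assoc (cW.incl x),
      A.form_assoc (S.dualIncl cV f)]
    ring

theorem decomposition_form [CharZero K]
    (hW : ∀ x y, W.form x y = A.form (cW.incl x) (cW.incl y)) (i j : ZMod 2) (a b : V) (x y : W)
    (f g : Module.Dual K V) (ha : a ∈ V.grade i) (hg : g ∈ V.dualGrade j) :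
    A.form (S.decomposition cV cW (a, x, f)) (S.decomposition cV cW (b, y, g)) =
      W.form x y + sgn K (i * j) * g a + f b := by
  have h1 := A.form_supersymm i j _ _ ((cV.mem_grade i a).1 ha) (S.dualIncl_mem_grade cV hg)
  rw [S.form_dualIncl, cV.proj_incl] at h1
  simp only [decomposition_apply, map_add, LinearMap.add_apply, h1, hW, S.form_dualIncl,
    cV.proj_incl, S.form_incl_f_incl_f, S.form_incl_f_incl_w, S.form_incl_w_incl_f,
    S.form_incl_w_mem cW _ (S.dualIncl_mem cV _), S.proj_f_incl_w cV cW,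
    S.proj_f_of_mem cV (S.dualIncl_mem cV _), map_zero]
  ring

include cV in
theorem isGeneralizedDoubleExtension [CharZero K] (hI : A.IsGradedIdeal I)
    (hW : ∀ x y, W.form x y = A.form (cW.incl x) (cW.incl y)) :
    IsGeneralizedDoubleExtension W V A :=
  ⟨S.extensionContext cV cW hI hW, S.decomposition cV cW, S.decomposition_mem_grade cV cW,
    fun i _ a b x y f g ha _ _ _ _ _ => S.decomposition_mul cV cW hI hW i a b x y f g ha,
    fun i j a b x y f g ha _ _ _ _ hg => S.decomposition_form cV cW hW i j a b x y f g ha hg⟩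

end IsotropicSplitting

end EvenSymmetricSuperalgebra

/-! ### Orthogonal ideals, simple algebras and the induction -/

namespace EvenSymmetricSuperalgebra

open AssocSuperalgebra

variable {K : Type u} [Field K]

/-- The orthogonal of a subspace. -/
def perp (A : EvenSymmetricSuperalgebra.{u, v} K) (I : Submodule K A) : Submodule K A where
  carrier := {x | ∀ y ∈ I, A.form x y = 0}
  zero_mem' y _ := by rw [map_zero, LinearMap.zero_apply]
  add_mem' ha hb y hy := by rw [map_add, LinearMap.add_apply, ha y hy, hb y hy, add_zero]
  smul_mem' c a ha y hy := by rw [map_smul, LinearMap.smul_apply, ha y hy, smul_zero]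

variable {A : EvenSymmetricSuperalgebra.{u, v} K} {I : Submodule K A}

theorem isGradedIdeal_perp (hI : A.IsGradedIdeal I) : A.IsGradedIdeal (A.perp I) where
  mul_mem_left a x hx y hy := by
    rw [form_mul_left]
    exact hx _ (hI.mul_mem_right _ y hy)
  mul_mem_right a x hx y hy := by
    rw [A.form_assoc]
    exact hx _ (hI.mul_mem_left _ y hy)
  parity_mem x hx y hy := by
    rw [A.form_parity_left]
    exact hx _ (hI.parity_mem y hy)

/-- A proper subspace is killed by a nonzero linear form, and the form of `A` represents it by a
vector. -/
theorem perp_ne_bot (hI : I ≠ ⊤) : A.perp I ≠ ⊥ := by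
  intro h
  obtain ⟨φ, hφ, hle⟩ := Submodule.exists_le_ker_of_lt_top I hI.lt_top
  have h1 : A.formEquiv.symm φ ∈ A.perp I := fun y hy => by
    rw [A.form_formEquiv_symm]
    exact hle hy
  rw [h, Submodule.mem_bot, LinearEquiv.map_eq_zero_iff] at h1
  exact hφ h1

/-- The form restricted to `I` is non-degenerate, so pairing with `y` on `I` is pairing with some
`x` in `I`, and `y - x` is orthogonal to `I`. -/
theorem isCompl_perp (h : Disjoint I (A.perp I)) : IsCompl I (A.perp I) := by
  refine ⟨h, ?_⟩
  rw [codisjoint_iff, eq_top_iff]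
  intro y _
  let r : A →ₗ[K] Module.Dual K I := A.form.compl₂ I.subtype
  have hinj : Function.Injective (r ∘ₗ I.subtype) := by
    rw [injective_iff_map_eq_zero]
    intro x hx
    exact Subtype.ext (Submodule.disjoint_def.1 h x.1 x.2 fun z hz => congr($hx ⟨z, hz⟩))
  obtain ⟨x, hx⟩ := (LinearMap.injective_iff_surjective_of_finrank_eq_finrank
    Subspace.dual_finrank_eq.symm).1 hinj (r y)
  refine Submodule.mem_sup.2 ⟨x.1, x.2, y - x.1, fun z hz => ?_, add_sub_cancel _ _⟩
  have : A.form x.1 z = A.form y z := congr($hx ⟨z, hz⟩)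
  rw [map_sub, LinearMap.sub_apply, this, sub_self]

/-- The summand of an orthogonal decomposition given by one of two complementary projections. -/
theorem exists_compression_of_orthogonal [CharZero K] (e f : A →ₗ[K] A)
    (hsum : ∀ x, e x + f x = x) (hfe : ∀ x, f (e x) = 0)
    (hσ : ∀ x, e (A.parity x) = A.parity (e x))
    (hform : ∀ x y, A.form (e x) (f y) = 0) (hform' : ∀ x y, A.form (f x) (e y) = 0)
    (hmul : ∀ x y, e x * f y = 0) :
    ∃ (W : EvenSymmetricSuperalgebra.{u, v} K)
      (c : Compression A.toAssocSuperalgebra W.toAssocSuperalgebra e),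
      (∀ x y, W.form x y = A.form (c.incl x) (c.incl y)) ∧
        ∀ x y, c.incl (x * y) = c.incl x * c.incl y := by
  have hee (x : A) : e (e x) = e x := by
    have := hsum (e x)
    rwa [hfe, add_zero] at this
  have hadj (x y : A) : A.form (e x) y = A.form x (e y) := by
    conv_lhs => rw [← hsum y]
    conv_rhs => rw [← hsum x]
    rw [map_add, map_add, LinearMap.add_apply, hform, hform']
  -- The range of `e` is closed under products: pairing `e x * e y` with `f z` moves to `e x`
  -- against `e y * f z = 0`.
  have hf (x y : A) : f (e x * e y) = 0 := A.form_nondeg _ fun z => by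
    have h1 : A.form (f (e x * e y)) z = A.form (f (e x * e y)) (f z) := by
      conv_lhs => rw [← hsum z]
      rw [map_add, hform', zero_add]
    have h2 : A.form (e x * e y) (f z) = A.form (f (e x * e y)) (f z) := by
      conv_lhs => rw [← hsum (e x * e y)]
      rw [map_add, LinearMap.add_apply, hform, zero_add]
    rw [h1, ← h2, A.form_assoc, hmul, map_zero]
  have hmule (x y : A) : e (e x * e y) = e x * e y := by
    have := hsum (e x * e y)
    rwa [hf, add_zero] at this
  obtain ⟨W, c, hW⟩ := exists_compression e hee hσ (fun x y z => by rw [hmule x y])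
    (fun x y z => by rw [hmule y z]) hadj
  refine ⟨W, c, hW, fun x y => ?_⟩
  rw [c.mul_eq, c.incl_proj, ← c.apply_incl x, ← c.apply_incl y, hmule]

/-- Complementary orthogonal projections with `(e x) (f y) = (f y) (e x) = 0` give an orthogonal
direct sum. -/
theorem exists_isOrthogonalSum [CharZero K] (e f : A →ₗ[K] A) (hsum : ∀ x, e x + f x = x)
    (hef : ∀ x, e (f x) = 0) (hfe : ∀ x, f (e x) = 0)
    (hσ : ∀ x, e (A.parity x) = A.parity (e x))
    (hform : ∀ x y, A.form (e x) (f y) = 0) (hform' : ∀ x y, A.form (f x) (e y) = 0)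
    (hmul : ∀ x y, e x * f y = 0) (hmul' : ∀ x y, f x * e y = 0)
    (he0 : ∃ x, e x ≠ 0) (hf0 : ∃ x, f x ≠ 0) :
    ∃ A₁ A₂ : EvenSymmetricSuperalgebra.{u, v} K, IsOrthogonalSum A₁ A₂ A ∧
      Module.finrank K A₁ < Module.finrank K A ∧ Module.finrank K A₂ < Module.finrank K A := by
  have hσ' (x : A) : f (A.parity x) = A.parity (f x) := by
    have h := hsum (A.parity x)
    rw [hσ] at h
    conv_rhs at h => rw [← hsum x, map_add]
    exact add_left_cancel h
  obtain ⟨A₁, c₁, h₁, hm₁⟩ :=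
    exists_compression_of_orthogonal e f hsum hfe hσ hform hform' hmul
  obtain ⟨A₂, c₂, h₂, hm₂⟩ := exists_compression_of_orthogonal f e
    (fun x => by rw [add_comm, hsum]) hef hσ' hform' hform hmul'
  have hp₁ (y : A₂) : c₁.proj (c₂.incl y) = 0 := by
    rw [c₁.proj_eq_zero, ← c₂.apply_incl, hef]
  have hp₂ (x : A₁) : c₂.proj (c₁.incl x) = 0 := by
    rw [c₂.proj_eq_zero, ← c₁.apply_incl, hfe]
  have hz₁ (x : A₁) (y : A₂) : c₁.incl x * c₂.incl y = 0 := by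
    rw [← c₁.apply_incl, ← c₂.apply_incl, hmul]
  have hz₂ (x : A₁) (y : A₂) : c₂.incl y * c₁.incl x = 0 := by
    rw [← c₁.apply_incl, ← c₂.apply_incl, hmul']
  have hB₁ (x : A₁) (y : A₂) : A.form (c₁.incl x) (c₂.incl y) = 0 := by
    rw [← c₁.apply_incl, ← c₂.apply_incl, hform]
  have hB₂ (x : A₁) (y : A₂) : A.form (c₂.incl y) (c₁.incl x) = 0 := by
    rw [← c₁.apply_incl, ← c₂.apply_incl, hform']
  obtain ⟨x₁, hx₁⟩ := he0
  obtain ⟨x₂, hx₂⟩ := hf0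
  let E : (A₁ × A₂) ≃ₗ[K] A :=
    LinearEquiv.ofLinearMap (c₁.incl.coprod c₂.incl) (c₁.proj.prod c₂.proj)
      (by
        ext y
        change c₁.incl (c₁.proj y) + c₂.incl (c₂.proj y) = y
        rw [c₁.incl_proj, c₂.incl_proj, hsum])
      (by
        refine LinearMap.ext fun ⟨x, y⟩ => Prod.ext ?_ ?_
        · change c₁.proj (c₁.incl x + c₂.incl y) = x
          rw [map_add, c₁.proj_incl, hp₁, add_zero]
        · change c₂.proj (c₁.incl x + c₂.incl y) = y
          rw [map_add, c₂.proj_incl, hp₂, zero_add])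
  have hE (x : A₁) (y : A₂) : E (x, y) = c₁.incl x + c₂.incl y := rfl
  refine ⟨A₁, A₂, ⟨E, fun i x y => ⟨fun h => ?_, fun h => ?_⟩, fun x x' y y' => ?_,
    fun x x' y y' => ?_⟩, c₁.finrank_lt hx₂ (hef x₂), c₂.finrank_lt hx₁ (hfe x₁)⟩
  · have h1 := c₁.proj_mem_grade hσ h
    have h2 := c₂.proj_mem_grade hσ' h
    rw [hE, map_add, c₁.proj_incl, hp₁, add_zero] at h1
    rw [hE, map_add, c₂.proj_incl, hp₂, zero_add] at h2
    exact ⟨h1, h2⟩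
  · exact add_mem ((c₁.mem_grade i x).1 h.1) ((c₂.mem_grade i y).1 h.2)
  · rw [hE, hE, hE, hm₁, hm₂, add_mul, mul_add, mul_add, hz₁, hz₂, add_zero, zero_add]
  · rw [hE, hE, h₁, h₂, map_add, map_add, LinearMap.add_apply, LinearMap.add_apply, hB₁,
      hB₂, add_zero, zero_add]

/-- The products of `I` with `I^⊥` lie in both ideals, hence vanish, so the vector space
decomposition is one of algebras. -/
theorem exists_isOrthogonalSum_of_disjoint [CharZero K] (hI : A.IsGradedIdeal I)
    (hd : Disjoint I (A.perp I)) (h0 : I ≠ ⊥) (h1 : I ≠ ⊤) :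
    ∃ A₁ A₂ : EvenSymmetricSuperalgebra.{u, v} K, IsOrthogonalSum A₁ A₂ A ∧
      Module.finrank K A₁ < Module.finrank K A ∧ Module.finrank K A₂ < Module.finrank K A := by
  have hc := isCompl_perp hd
  have hP := isGradedIdeal_perp hI
  let e := I.projection (A.perp I) hc
  let f := (A.perp I).projection I hc.symm
  have heI (x : A) : e x ∈ I := Submodule.projection_apply_mem _ _
  have hfP (x : A) : f x ∈ A.perp I := Submodule.projection_apply_mem _ _
  have he (x : A) (hx : x ∈ I) : e x = x := Submodule.projection_apply_of_mem_left _ hx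
  have he' (x : A) (hx : x ∈ A.perp I) : e x = 0 := Submodule.projection_apply_of_mem_right _ hx
  have hf (x : A) (hx : x ∈ A.perp I) : f x = x := Submodule.projection_apply_of_mem_left _ hx
  have hf' (x : A) (hx : x ∈ I) : f x = 0 := Submodule.projection_apply_of_mem_right _ hx
  have hdec (x : A) : ∃ y ∈ I, ∃ z ∈ A.perp I, y + z = x := by
    have hx : x ∈ I ⊔ A.perp I := by rw [hc.sup_eq_top]; trivial
    exact Submodule.mem_sup.1 hx
  have hmul {x y : A} (hx : x ∈ I) (hy : y ∈ A.perp I) : x * y = 0 ∧ y * x = 0 :=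
    ⟨Submodule.disjoint_def.1 hd _ (hI.mul_mem_right y x hx) (hP.mul_mem_left x y hy),
      Submodule.disjoint_def.1 hd _ (hI.mul_mem_left y x hx) (hP.mul_mem_right x y hy)⟩
  refine exists_isOrthogonalSum e f (fun x => ?_) (fun x => he' _ (hfP x)) (fun x => hf' _ (heI x))
    (fun x => ?_) (fun x y => ?_) (fun x y => hfP x _ (heI y))
    (fun x y => (hmul (heI x) (hfP y)).1) (fun x y => (hmul (heI y) (hfP x)).2) ?_ ?_
  · obtain ⟨y, hy, z, hz, rfl⟩ := hdec x
    rw [map_add, map_add, he y hy, he' z hz, hf' y hy, hf z hz, add_zero, zero_add]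
  · obtain ⟨y, hy, z, hz, rfl⟩ := hdec x
    rw [map_add, map_add, map_add, he _ (hI.parity_mem y hy), he' _ (hP.parity_mem z hz), he y hy,
      he' z hz, add_zero, add_zero]
  · rw [A.form_comm]
    exact hfP y _ (hI.parity_mem _ (heI x))
  · obtain ⟨x, hx, hx0⟩ := Submodule.exists_mem_ne_zero_of_ne_bot h0
    exact ⟨x, by rwa [he x hx]⟩
  · obtain ⟨x, hx, hx0⟩ := Submodule.exists_mem_ne_zero_of_ne_bot (perp_ne_bot h1)
    exact ⟨x, by rwa [hf x hx]⟩

/-- The preimage in `A` of a graded ideal of `V` contains `I^⊥`, so its orthogonal is a graded ideal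
inside `I`, that is `0` or `I`. These two cases give back all of `V` and `0`. -/
theorem IsotropicSplitting.isGradedSimple_of_minimal [CharZero K] (S : A.IsotropicSplitting I)
    {V : AssocSuperalgebra.{u, v} K} (cV : Compression A.toAssocSuperalgebra V S.f)
    (hI : A.IsGradedIdeal I) (hmin : ∀ J, A.IsGradedIdeal J → J ≤ I → J = ⊥ ∨ J = I) :
    V.IsGradedSimple := by
  intro J hJ
  let J' : Submodule K A := J.comap cV.proj
  have hJ' : A.IsGradedIdeal J' := by
    refine ⟨fun a x hx => ?_, fun a x hx => ?_, fun x hx => ?_⟩ <;>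
      rw [Submodule.mem_comap] at hx ⊢
    · rw [S.proj_f_mul cV hI]
      exact hJ.mul_mem_left _ _ hx
    · rw [S.proj_f_mul cV hI]
      exact hJ.mul_mem_right _ _ hx
    · have hp : cV.proj (A.parity x) = V.parity (cV.proj x) := by
        refine cV.incl_injective ?_
        rw [cV.incl_parity, cV.incl_proj, cV.incl_proj, S.f_parity]
      rw [hp]
      exact hJ.parity_mem _ hx
  have hle : A.perp J' ≤ I := by
    intro x hx
    have : S.e x = x := A.form_ext fun z => by
      have hz : z - S.f z ∈ J' := by
        rw [Submodule.mem_comap, map_sub, cV.proj_apply, sub_self]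
        exact J.zero_mem
      have := hx _ hz
      rw [map_sub, sub_eq_zero] at this
      rw [S.form_e, this]
    rw [← this]
    exact S.e_mem x
  rcases hmin _ (isGradedIdeal_perp hJ') hle with h | h
  · right
    have htop : J' = ⊤ := by
      by_contra hne
      exact perp_ne_bot hne h
    rw [eq_top_iff]
    intro a _
    have ha : cV.incl a ∈ J' := by rw [htop]; trivial
    rwa [Submodule.mem_comap, cV.proj_incl] at ha
  · left
    rw [eq_bot_iff]
    intro a ha
    have ha' : cV.incl a ∈ J' := by rwa [Submodule.mem_comap, cV.proj_incl]
    rw [Submodule.mem_bot]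
    refine cV.incl_injective ?_
    rw [map_zero]
    refine A.form_nondeg _ fun z => ?_
    rw [← S.form_incl_f, A.form_comm, ← A.form_parity_left]
    have hz : A.parity (S.e z) ∈ A.perp J' := by
      rw [h]
      exact hI.parity_mem _ (S.e_mem z)
    exact hz _ ha'

/-- `Q_n(K)` carries no even-symmetric structure. -/
theorem not_isQueerSuperalgebra [CharZero K] [Nontrivial A] :
    ¬ A.toAssocSuperalgebra.IsQueerSuperalgebra := by
  rintro ⟨n, -, e, hmul, hgrade⟩
  let o' : queerSuperalgebra K n := (⟨Matrix.fromBlocks 1 0 0 1, rfl, rfl⟩ : queerSubalgebra K n)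
  let u' : queerSuperalgebra K n := (⟨Matrix.fromBlocks 0 1 1 0, rfl, rfl⟩ : queerSubalgebra K n)
  have hou (x : queerSuperalgebra K n) : o' * x = x ∧ x * u' = u' * x ∧ u' * u' = o' := by
    obtain ⟨M, h1, h2⟩ := x
    refine ⟨Subtype.ext ?_, Subtype.ext ?_, Subtype.ext ?_⟩
    · change Matrix.fromBlocks 1 0 0 1 * M = M
      rw [Matrix.fromBlocks_one, one_mul]
    · change M * Matrix.fromBlocks 0 1 1 0 = Matrix.fromBlocks 0 1 1 0 * M
      rw [← Matrix.fromBlocks_toBlocks M, Matrix.fromBlocks_multiply, Matrix.fromBlocks_multiply,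
        h1, h2]
      simp
    · change Matrix.fromBlocks 0 1 1 0 * Matrix.fromBlocks 0 1 1 0 = Matrix.fromBlocks 1 0 0 1
      rw [Matrix.fromBlocks_multiply]
      simp
  have ho'g : o' ∈ (queerSuperalgebra K n).grade 0 := by
    change Matrix.fromBlocks 1 0 0 1 ∈ matrixGrade K n n 0
    rintro (a | a) (b | b) h
    · exact absurd rfl h
    · rfl
    · rfl
    · exact absurd (show (1 + 1 : ZMod 2) = 0 by decide) h
  have hu'g : u' ∈ (queerSuperalgebra K n).grade 1 := by
    change Matrix.fromBlocks 0 1 1 0 ∈ matrixGrade K n n 1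
    rintro (a | a) (b | b) h
    · rfl
    · exact absurd rfl h
    · exact absurd rfl h
    · rfl
  obtain ⟨o, ho⟩ := e.surjective o'
  obtain ⟨q, hq⟩ := e.surjective u'
  have hog : o ∈ A.grade 0 := by rwa [← hgrade, ho]
  have hqg : q ∈ A.grade 1 := by rwa [← hgrade, hq]
  have hox (x : A) : o * x = x := e.injective (by rw [hmul, ho, (hou _).1])
  have hqx (x : A) : x * q = q * x := e.injective (by rw [hmul, hmul, hq, (hou _).2.1])
  have hqq : q * q = o := e.injective (by rw [hmul, hq, ho, (hou o').2.2])
  -- The odd element `q` is central with `q² = 1`. For even `x`, `B(x, 1) = B(q x, q)`, and this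
  -- value equals `B(q, q x)` by centrality and invariance but `-B(q, q x)` by supersymmetry.
  have h0 (x : A) (hx : x ∈ A.grade 0) : A.form x o = 0 := by
    have hqxg : q * x ∈ A.grade 1 := A.mul_mem_grade 1 0 q x hqg hx
    have h1 := A.form_supersymm 1 1 _ _ hqxg hqg
    have h2 := A.form_assoc q x q
    rw [hqx] at h2
    rw [one_mul, sgn_one, ← h2, ← hqx, A.form_assoc, hqq] at h1
    have h3 : (2 : K) * A.form x o = 0 := by linear_combination h1
    exact (mul_eq_zero.1 h3).resolve_left two_ne_zero
  have h1 (x : A) : A.form x o = 0 := by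
    obtain ⟨y, hy, z, hz, rfl⟩ := A.exists_eq_add x
    rw [map_add, LinearMap.add_apply, h0 y hy, A.form_even 1 0 z o hz hog (by decide), add_zero]
  have h2 : o = 0 := A.form_nondeg _ fun x => by
    rw [A.form_comm, mem_grade_zero_iff.1 hog, h1]
  obtain ⟨x, hx⟩ := exists_ne (0 : A)
  apply hx
  rw [← hox x, h2, zero_mul]

/-- On the odd part the form is alternating, so it vanishes on a line. -/
theorem not_isNullLine_one [CharZero K] : ¬ A.toAssocSuperalgebra.IsNullLine 1 := by
  rintro ⟨h1, htop, -⟩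
  obtain ⟨x, hx, hspan⟩ := finrank_eq_one_iff'.1 h1
  refine hx (A.form_nondeg _ fun y => ?_)
  obtain ⟨c, rfl⟩ := hspan y
  have hxg : x ∈ A.grade 1 := by rw [htop]; trivial
  have h := A.form_supersymm 1 1 x x hxg hxg
  rw [one_mul, sgn_one] at h
  have h3 : (2 : K) * A.form x x = 0 := by linear_combination h
  rw [map_smul, (mul_eq_zero.1 h3).resolve_left two_ne_zero, smul_zero]

theorem inO_of_isGradedSimple [CharZero K] [IsAlgClosed K] (hA : A.IsGradedSimple) : InO A := by
  rcases subsingleton_or_nontrivial A with h | h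
  · exact Or.inl h
  · by_cases h0 : ∃ x y : A, x * y ≠ 0
    · exact Or.inr (Or.inr ((hA.isMatrix_or_isQueer h0).resolve_right not_isQueerSuperalgebra))
    · push Not at h0
      exact Or.inr (Or.inl ((hA.isNullLine h0).resolve_right not_isNullLine_one))

/-- The induction hypothesis applies to `W`, whose dimension drops because `w` kills `I`. The
algebra `V` is graded simple, and its four possible types match the four kinds of extension. Here
`Q_n(K)` and the odd line do occur, since `V` carries no form. -/
theorem obtainedFromO_of_isotropic [CharZero K] [IsAlgClosed K] (hI : A.IsGradedIdeal I)
    (h0 : I ≠ ⊥) (hmin : ∀ J, A.IsGradedIdeal J → J ≤ I → J = ⊥ ∨ J = I)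
    (hiso : ∀ x ∈ I, ∀ y ∈ I, A.form x y = 0)
    (ih : ∀ W : EvenSymmetricSuperalgebra.{u, v} K,
      Module.finrank K W < Module.finrank K A → ObtainedFromO W) : ObtainedFromO A := by
  obtain ⟨S⟩ := A.exists_isotropicSplitting I hI.parity_mem hiso
  obtain ⟨V, ⟨cV⟩⟩ := S.exists_compression_f hI
  obtain ⟨W, cW, hW⟩ := S.exists_compression_w hI
  have hext := S.isGeneralizedDoubleExtension cV cW hI hW
  have hV := S.isGradedSimple_of_minimal cV hI hmin
  obtain ⟨x, hx, hx0⟩ := Submodule.exists_mem_ne_zero_of_ne_bot h0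
  have hWO : ObtainedFromO W := ih W (cW.finrank_lt hx0 (S.w_of_mem hx))
  have : Nontrivial V := by
    by_contra h
    rw [not_nontrivial_iff_subsingleton] at h
    refine hx0 (A.form_nondeg _ fun z => ?_)
    rw [← S.e_of_mem x hx, S.form_e, ← cV.incl_proj, Subsingleton.elim (cV.proj z) 0, map_zero,
      map_zero]
  by_cases hV0 : ∃ x y : V, x * y ≠ 0
  · rcases hV.isMatrix_or_isQueer hV0 with h | h
    · exact .extensionByMatrix W V A hWO h hext
    · exact .extensionByQueer W V A hWO h hext
  · push Not at hV0
    rcases hV.isNullLine hV0 with h | h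
    · exact .evenExtension W V A hWO h hext
    · exact .oddExtension W V A hWO h hext

theorem obtainedFromO [CharZero K] [IsAlgClosed K] (A : EvenSymmetricSuperalgebra.{u, v} K) :
    ObtainedFromO A := by
  induction hn : Module.finrank K A using Nat.strong_induction_on generalizing A with
  | _ n ih =>
  subst hn
  have ih' (W : EvenSymmetricSuperalgebra.{u, v} K)
      (hW : Module.finrank K W < Module.finrank K A) : ObtainedFromO W := ih _ hW W rfl
  by_cases hA : A.IsGradedSimple
  · exact .base A (inO_of_isGradedSimple hA)
  have hne : {I : Submodule K A | A.IsGradedIdeal I ∧ I ≠ ⊥ ∧ I ≠ ⊤}.Nonempty := by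
    by_contra h
    refine hA fun I hI => ?_
    by_contra! h'
    exact h ⟨I, hI, h'⟩
  -- A minimal proper nonzero graded ideal is minimal among all nonzero graded ideals contained in
  -- it, since none of these can be `A`.
  obtain ⟨I, ⟨hI, h0, h1⟩, hmin⟩ := WellFounded.has_min (wellFounded_lt (α := Submodule K A)) _ hne
  have hmin' (J : Submodule K A) (hJ : A.IsGradedIdeal J) (hle : J ≤ I) : J = ⊥ ∨ J = I := by
    by_contra! h
    exact hmin J ⟨hJ, h.1, fun h2 => h1 (top_le_iff.1 (h2 ▸ hle))⟩ (lt_of_le_of_ne hle h.2)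
  have hP := isGradedIdeal_perp hI
  have hIP : A.IsGradedIdeal (I ⊓ A.perp I) :=
    ⟨fun a x hx => ⟨hI.mul_mem_left a x hx.1, hP.mul_mem_left a x hx.2⟩,
      fun a x hx => ⟨hI.mul_mem_right a x hx.1, hP.mul_mem_right a x hx.2⟩,
      fun x hx => ⟨hI.parity_mem x hx.1, hP.parity_mem x hx.2⟩⟩
  rcases hmin' _ hIP inf_le_left with h | h
  · obtain ⟨A₁, A₂, hsum, hl1, hl2⟩ :=
      exists_isOrthogonalSum_of_disjoint hI (disjoint_iff.2 h) h0 h1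
    exact .orthogonalSum A₁ A₂ A (ih' A₁ hl1) (ih' A₂ hl2) hsum
  · exact obtainedFromO_of_isotropic hI h0 hmin' (fun x hx => (inf_eq_left.1 h) hx) ih'

end EvenSymmetricSuperalgebra

theorem mainTheorem5 {K : Type u} [Field K] [IsAlgClosed K] [CharZero K]
    (A : EvenSymmetricSuperalgebra.{u, v} K)
    (hA : ¬ EvenSymmetricSuperalgebra.InO A) :
    EvenSymmetricSuperalgebra.ObtainedFromO A :=
  A.obtainedFromO
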